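/- Let $S^2$ be the two-sphere. For a $U(1)$-bundle $L\to S^2$ with connection $A$, regard $A$ as given by real local one-forms, let $F=dA$ be its curvature, viewed as a real closed two-form on $S^2$, and let $|[F]|:=\left|\int_{S^2}F\right|$ be the size of its class $[F]$ under the identification $H^2(S^2;\mathbb{R})\cong\mathbb{R}$ given by integration. A solution of the Ricci Yang–Mills flow on $S^2$ is a smooth family $(g(t),A(t))$, $t\in I$, of Riemannian metrics on $S^2$ and connections on a fixed $U(1)$-bundle $L\to S^2$, where $I$ is a nondegenerate interval with least element $0$, such that $$\frac{\partial}{\partial t}g_{ij}=-2\,\mathrm{Rc}_{ij}+g^{kl}F_{ik}F_{jl},\qquad \frac{\partial}{\partial t}A=-d^*F,$$ where the Ricci tensor $\mathrm{Rc}$ and the codifferential $d^*$ are those of $g(t)$ and $F=F(t)$ is the curvature of $A(t)$. For every smooth Riemannian metric $g_0$ on $S^2$ and every real number $c>0$ there is a constant $C=C(g_0,c)>0$ such that, for every solution $(g(t),A(t))_{t\in I}$ of the Ricci Yang–Mills flow on $S^2$ (on any $U(1)$-bundle) with $g(0)=g_0$ and $|[F]|=c$ at $t=0$ (so that $[F]\neq0$),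 $$\mathrm{Vol}(g(t))\ge C\qquad\text{for all } t\in I .$$ -/

import Mathlib

open MeasureTheory
open scoped Manifold ContDiff

noncomputable section

namespace RYM

/-- The plane, in which local coordinates on the sphere take their values. -/
abbrev Plane : Type := EuclideanSpace ℝ (Fin 2)

/-- The smooth two-sphere, with Mathlib's (stereographic) atlas. -/
abbrev S2 : Type := Metric.sphere (0 : EuclideanSpace ℝ (Fin (2 + 1))) 1

/-- Smooth Riemannian metrics on the sphere. -/
abbrev SphereMetric : Type :=
  Bundle.ContMDiffRiemannianMetric (𝓡 2) ∞ Plane (fun x : S2 => TangentSpace (𝓡 2) x)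

/-! ### Local coordinates

The chart at `p` is stereographic projection from `-p`; its inverse is a parametrization of the
sphere minus the point `-p` by the whole plane. -/

/-- The inverse of the preferred chart at `p`. -/
def param (p : S2) : Plane → S2 := (extChartAt (𝓡 2) p).symm

theorem chart_target (p : S2) : (extChartAt (𝓡 2) p).target = Set.univ := by
  have : Fact (Module.finrank ℝ (EuclideanSpace ℝ (Fin (2 + 1))) = 2 + 1) := ⟨by simp⟩
  have h : (chartAt Plane p).target = Set.univ := stereographic'_target (n := 2) (-p)
  simp [h]

theorem range_param (p : S2) : Set.range (param p) = {-p}ᶜ := by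
  have : Fact (Module.finrank ℝ (EuclideanSpace ℝ (Fin (2 + 1))) = 2 + 1) := ⟨by simp⟩
  have h : (chartAt Plane p).source = {-p}ᶜ := stereographic'_source (n := 2) (-p)
  rw [← h, ← extChartAt_source (𝓡 2) p, ← (extChartAt (𝓡 2) p).symm_image_target_eq_source,
    chart_target, Set.image_univ, param]

/-- The standard basis vector `e i` of the plane. -/
def e (i : Fin 2) : Plane := EuclideanSpace.single i 1

/-- The coordinate vector field `∂ᵢ` of the chart at `p`, at the point with coordinates `y`. -/
def coordVec (p : S2) (y : Plane) (i : Fin 2) : TangentSpace (𝓡 2) (param p y) :=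
  mfderiv 𝓘(ℝ, Plane) (𝓡 2) (param p) y (e i)

/-- The partial derivative `∂ᵢ f` in the plane. -/
def pd (i : Fin 2) (f : Plane → ℝ) (y : Plane) : ℝ := fderiv ℝ f y (e i)

/-- The components `g_ij` of a metric in the chart at `p`. -/
def metricCoord (g : SphereMetric) (p : S2) (y : Plane) : Matrix (Fin 2) (Fin 2) ℝ :=
  Matrix.of fun i j => g.inner (param p y) (coordVec p y i) (coordVec p y j)

/-! ### Curvature of a metric given by its components -/

/-- Christoffel symbols `Γᵏᵢⱼ = ½ gᵏˡ (∂ᵢ g_jl + ∂ⱼ g_il - ∂ₗ g_ij)`. -/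
def christoffel (G : Plane → Matrix (Fin 2) (Fin 2) ℝ) (k i j : Fin 2) (y : Plane) : ℝ :=
  (1 / 2) * ∑ l, (G y)⁻¹ k l *
    (pd i (fun z => G z j l) y + pd j (fun z => G z i l) y - pd l (fun z => G z i j) y)

/-- Ricci tensor `Rᵢⱼ = ∂ₖ Γᵏᵢⱼ - ∂ⱼ Γᵏᵢₖ + Γᵏₖₗ Γˡᵢⱼ - Γᵏⱼₗ Γˡᵢₖ`. -/
def ricci (G : Plane → Matrix (Fin 2) (Fin 2) ℝ) (i j : Fin 2) (y : Plane) : ℝ :=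
  (∑ k, pd k (christoffel G k i j) y) - (∑ k, pd j (christoffel G k i k) y)
    + (∑ k, ∑ l, christoffel G k k l y * christoffel G l i j y)
    - (∑ k, ∑ l, christoffel G k j l y * christoffel G l i k y)

/-- Covariant derivative `∇ₖ F_ij = ∂ₖ F_ij - Γˡₖᵢ F_lj - Γˡₖⱼ F_il` of a two-tensor. -/
def covDeriv (G F : Plane → Matrix (Fin 2) (Fin 2) ℝ) (k i j : Fin 2) (y : Plane) : ℝ :=
  pd k (fun z => F z i j) y - (∑ l, christoffel G l k i y * F y l j)
    - (∑ l, christoffel G l k j y * F y i l)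

/-- The codifferential `(d* F)_j = - gⁱᵏ ∇ₖ F_ij` of a two-form. -/
def codiff (G F : Plane → Matrix (Fin 2) (Fin 2) ℝ) (j : Fin 2) (y : Plane) : ℝ :=
  - ∑ i, ∑ k, (G y)⁻¹ i k * covDeriv G F k i j y

/-! ### `U(1)`-bundles and connections -/

/-- A smooth `U(1)`-bundle over the sphere, given by an open cover (indexed by `ι`) and a smooth
`U(1)`-valued cocycle of transition functions (any value is allowed off the overlaps).
`indexAt` picks a member of the cover around each point. -/
structure U1Bundle (ι : Type*) where
  baseSet : ι → Set S2
  isOpen_baseSet : ∀ α, IsOpen (baseSet α)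
  indexAt : S2 → ι
  mem_baseSet_at : ∀ x, x ∈ baseSet (indexAt x)
  trans : ι → ι → S2 → Circle
  smooth_trans : ∀ α β, ContMDiffOn (𝓡 2) 𝓘(ℝ, ℂ) ∞ (fun x => (trans α β x : ℂ))
    (baseSet α ∩ baseSet β)
  cocycle : ∀ α β γ x, x ∈ baseSet α → x ∈ baseSet β → x ∈ baseSet γ →
    trans α β x * trans β γ x = trans α γ x

/-- The components of a (local) one-form in the chart at `p`. -/
def formCoord (a : (x : S2) → TangentSpace (𝓡 2) x →L[ℝ] ℝ) (p : S2) (j : Fin 2) (y : Plane) : ℝ :=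
  a (param p y) (coordVec p y j)

/-- A smooth connection on a `U(1)`-bundle: real one-forms `A_α` on the members of the cover (the
connection form in the local section of index `α` is `i A_α`; values off `baseSet α` are
irrelevant) with `A_β - A_α = -i τ⁻¹ dτ` on overlaps, `τ = trans α β`. -/
structure U1Connection {ι : Type*} (L : U1Bundle ι) where
  form : ι → (x : S2) → TangentSpace (𝓡 2) x →L[ℝ] ℝ
  smooth_form : ∀ α p j, ContDiffOn ℝ ∞ (formCoord (form α) p j) (param p ⁻¹' L.baseSet α)
  gauge : ∀ α β x, x ∈ L.baseSet α → x ∈ L.baseSet β → ∀ v : TangentSpace (𝓡 2) x,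
    (mfderiv (𝓡 2) 𝓘(ℝ, ℂ) (fun z => (L.trans α β z : ℂ)) x v : ℂ)
      = Complex.I * ((form β x v - form α x v : ℝ) : ℂ) * (L.trans α β x : ℂ)

/-- The components `F_ij = ∂ᵢ A_j - ∂ⱼ A_i` of the curvature `F = dA` (as a real two-form) in the
chart at `p`. The gauge condition makes the choice of the local one-form immaterial. -/
def curvCoord {ι : Type*} {L : U1Bundle ι} (A : U1Connection L) (p : S2) (y : Plane) :
    Matrix (Fin 2) (Fin 2) ℝ :=
  Matrix.of fun i j =>
    pd i (formCoord (A.form (L.indexAt (param p y))) p j) y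
      - pd j (formCoord (A.form (L.indexAt (param p y))) p i) y

/-! ### Volume and the class of the curvature

Integrals over the sphere are computed in one stereographic chart, whose domain is the
sphere minus a single point (see `range_param`), hence of full measure. -/

/-- A base point for the chart in which integrals are computed. -/
def pole : S2 := ⟨EuclideanSpace.single 0 1, by simp⟩

/-- The total volume `∫ dV_g = ∫ √(det g_ij) dy`. -/
def Vol (g : SphereMetric) : ℝ := ∫ y, Real.sqrt (metricCoord g pole y).det

/-- The class `[F]` under the isomorphism `H²(S²; ℝ) ≅ ℝ` given by integration,
i.e. the number `∫ F`, the sphere being oriented by the chart at `pole`. -/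
def curvClass {ι : Type*} {L : U1Bundle ι} (A : U1Connection L) : ℝ :=
  ∫ y, curvCoord A pole y 0 1

/-! ### The flow -/

/-- `(g(t), A(t))`, `t ∈ I`, is a smooth solution of the Ricci Yang-Mills flow
`∂ₜ g_ij = -2 Rc_ij + gᵏˡ F_ik F_jl`, `∂ₜ A = - d* F` on the bundle `L`, where `I` is a
nondegenerate interval with least element `0` (such as `[0, T)`, `[0, T]` or `[0, ∞)`). -/
structure IsRYMFlow {ι : Type*} (L : U1Bundle ι) (I : Set ℝ) (g : ℝ → SphereMetric)
    (A : ℝ → U1Connection L) : Prop where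
  isLeast : IsLeast I 0
  ordConnected : I.OrdConnected
  nontrivial : I.Nontrivial
  smooth_metric : ∀ p i j, ContDiffOn ℝ ∞
    (fun z : ℝ × Plane => metricCoord (g z.1) p z.2 i j) (I ×ˢ Set.univ)
  smooth_connection : ∀ α p j, ContDiffOn ℝ ∞
    (fun z : ℝ × Plane => formCoord ((A z.1).form α) p j z.2) (I ×ˢ (param p ⁻¹' L.baseSet α))
  metric_eq : ∀ t ∈ I, ∀ p y i j, HasDerivWithinAt (fun s => metricCoord (g s) p y i j)
    (-2 * ricci (metricCoord (g t) p) i j y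
      + ∑ k, ∑ l, (metricCoord (g t) p y)⁻¹ k l * curvCoord (A t) p y i k * curvCoord (A t) p y j l)
    I t
  connection_eq : ∀ t ∈ I, ∀ α p y j, param p y ∈ L.baseSet α →
    HasDerivWithinAt (fun s => formCoord ((A s).form α) p j y)
      (- codiff (metricCoord (g t) p) (curvCoord (A t) p) j y) I t

end RYM

end

/-!
Along the Ricci Yang-Mills flow on the sphere the metric changes conformally: writing
`F = f dV`, the equation reads `∂ₜ g = (-2 K + f²) g`, since `Rc = K g` in dimension two
(`ricci_eq`). Hence the volume `v` satisfies `v' = -2 ∫ K dV + ∫ f² dV`. The total curvature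
`∫ K dV` and the class `∫ F` do not change in time, and `∫ f² dV ≥ (∫ F)² / v` by the
Cauchy-Schwarz inequality. So `v' > 0` as soon as `v` is small compared with `c²` divided by the
total curvature, which bounds `v` from below (`le_of_deriv_pos_of_lt`).

The two conservation laws are proved without integration on manifolds. In the chart at `pole` both
`K dV` and `F(t) - F(0)` are exterior derivatives of one-forms on the plane: of the connection form
`connForm` by Liouville's formula, and of the components of the global one-form `A(t) - A(0)`. With
a cutoff at radius `R = s⁻¹` Stokes' theorem turns their integrals into boundary terms
(`integral_cutoff_mul_curl`). The change to the chart at `-pole` is homogeneous of degree `-1`, so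
after rescaling the boundary terms are continuous functions of `(s, t)` up to and including `s = 0`
(`metricCoord_smul`, `formCoord_smul`). At `s = 0` the term for the connections vanishes, and the
term for the curvature depends only on the metric at the single point `-pole` up to a constant
factor, hence not on time (`curvatureFlux_zero`). The Gauss-Bonnet theorem is not needed: the
constant may depend on the total curvature of the initial metric. By compactness of `[0, T]` there
is one cutoff radius at which all errors are small for all times up to `T`, and the differential
inequality is then applied to the cut-off volume (`exists_hasDerivAt_cutoffVol`).
-/

open scoped RealInnerProductSpace

noncomputable section

namespace RYM

/-! ### The transition map between opposite charts -/

theorem contMDiff_param (p : S2) : ContMDiff 𝓘(ℝ, Plane) (𝓡 2) ∞ (param p) := by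
  have h := contMDiffOn_extChartAt_symm (I := 𝓡 2) (n := ∞) p
  rw [chart_target] at h
  exact contMDiffOn_univ.1 h

theorem injective_mfderiv_param (p : S2) (y : Plane) :
    Function.Injective (mfderiv 𝓘(ℝ, Plane) (𝓡 2) (param p) y) := by
  have h := isInvertible_mfderivWithin_extChartAt_symm (I := 𝓡 2) (x := p) (y := y)
    (by rw [chart_target]; trivial)
  have hr : Set.range (𝓡 2) = Set.univ := by simp
  rw [hr, mfderivWithin_univ] at h
  exact h.injective

/-- The chart at `-p` is centred at the antipode of `p`, so the change between the two charts is
inversion in the circle of radius `2` followed by a linear isometry. Only its shape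
`y ↦ Q (y / ‖y‖²)`, with `Q` linear, is recorded: it makes the transition map homogeneous of
degree `-1`. -/
theorem exists_param_eq_param_neg (p : S2) : ∃ Q : Plane →L[ℝ] Plane, ∀ y : Plane, y ≠ 0 →
    param p y = param (-p) (Q ((‖y‖ ^ 2)⁻¹ • y)) := by
  have : Fact (Module.finrank ℝ (EuclideanSpace ℝ (Fin (2 + 1))) = 2 + 1) := ⟨by simp⟩
  let v : S2 := -p
  let w : S2 := - -p
  have hvw : (w : EuclideanSpace ℝ (Fin (2 + 1))) = -v := by simp [v, w]
  let U : (ℝ ∙ (v : EuclideanSpace ℝ (Fin (2 + 1))))ᗮ ≃ₗᵢ[ℝ] Plane :=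
    (OrthonormalBasis.fromOrthogonalSpanSingleton 2 (ne_zero_of_mem_unit_sphere v)).repr
  let U' : (ℝ ∙ (w : EuclideanSpace ℝ (Fin (2 + 1))))ᗮ ≃ₗᵢ[ℝ] Plane :=
    (OrthonormalBasis.fromOrthogonalSpanSingleton 2 (ne_zero_of_mem_unit_sphere w)).repr
  let P := (ℝ ∙ (w : EuclideanSpace ℝ (Fin (2 + 1))))ᗮ.orthogonalProjectionOnto
  refine ⟨(4 : ℝ) • ((U'.toContinuousLinearEquiv : _ →L[ℝ] Plane) ∘L P ∘L
    (ℝ ∙ (v : EuclideanSpace ℝ (Fin (2 + 1))))ᗮ.subtypeL ∘L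
      (U.symm.toContinuousLinearEquiv : Plane →L[ℝ] _)), fun y hy => ?_⟩
  have hx : ((param p y : S2) : EuclideanSpace ℝ (Fin (2 + 1))) =
      (‖y‖ ^ 2 + 4)⁻¹ • (4 : ℝ) • (U.symm y : EuclideanSpace ℝ (Fin (2 + 1))) +
        (‖y‖ ^ 2 + 4)⁻¹ • (‖y‖ ^ 2 - 4) • v.val := by
    have := stereographic'_symm_apply (n := 2) v y
    have hn : ‖(U.symm y : EuclideanSpace ℝ (Fin (2 + 1)))‖ = ‖y‖ := by
      rw [Submodule.norm_coe, LinearIsometryEquiv.norm_map]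
    change _ = (‖(U.symm y : EuclideanSpace ℝ (Fin (2 + 1)))‖ ^ 2 + 4)⁻¹ • (4 : ℝ) • _ +
        (‖(U.symm y : EuclideanSpace ℝ (Fin (2 + 1)))‖ ^ 2 + 4)⁻¹ •
          (‖(U.symm y : EuclideanSpace ℝ (Fin (2 + 1)))‖ ^ 2 - 4) • v.val at this
    rw [hn] at this
    exact this
  have hvn : ‖(v : EuclideanSpace ℝ (Fin (2 + 1)))‖ = 1 := norm_eq_of_mem_sphere v
  have hu : ⟪(v : EuclideanSpace ℝ (Fin (2 + 1))),
      (U.symm y : EuclideanSpace ℝ (Fin (2 + 1)))⟫ = 0 :=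
    Submodule.mem_orthogonal_singleton_iff_inner_right.mp (U.symm y).2
  have hy2 : 0 < ‖y‖ ^ 2 := by positivity
  have hvx : ⟪(v : EuclideanSpace ℝ (Fin (2 + 1))), (param p y : S2)⟫ =
      (‖y‖ ^ 2 + 4)⁻¹ * (‖y‖ ^ 2 - 4) := by
    rw [hx, inner_add_right, inner_smul_right, inner_smul_right, inner_smul_right,
      inner_smul_right, hu, real_inner_self_eq_norm_sq, hvn]
    ring
  have hmem : param p y ∈ (extChartAt (𝓡 2) (-p)).source := by
    have : (chartAt Plane (-p)).source = {- -p}ᶜ := stereographic'_source (n := 2) (- -p)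
    rw [extChartAt_source, this]
    intro h
    have h1 : ((param p y : S2) : EuclideanSpace ℝ (Fin (2 + 1))) = -v := by
      rw [Set.mem_singleton_iff.1 h]; exact hvw
    rw [h1, inner_neg_right, real_inner_self_eq_norm_sq, hvn] at hvx
    field_simp at hvx
    linarith
  -- the axis of the projection is orthogonal to its target plane
  have hPv : P (v : EuclideanSpace ℝ (Fin (2 + 1))) = 0 := by
    have h := Submodule.orthogonalProjectionOnto_orthogonalComplement_singleton_eq_zero (𝕜 := ℝ)
      (w : EuclideanSpace ℝ (Fin (2 + 1)))
    have h2 : (v : EuclideanSpace ℝ (Fin (2 + 1))) = -w := by rw [hvw, neg_neg]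
    rw [h2, map_neg, h, neg_zero]
  have hT : extChartAt (𝓡 2) (-p) (param p y) =
      (4 : ℝ) • U' (P (U.symm ((‖y‖ ^ 2)⁻¹ • y) : EuclideanSpace ℝ (Fin (2 + 1)))) := by
    have h1 : extChartAt (𝓡 2) (-p) (param p y) =
      U' (stereoToFun (w : EuclideanSpace ℝ (Fin (2 + 1))) (param p y)) := rfl
    have h2 : (1 : ℝ) - innerSL ℝ (w : EuclideanSpace ℝ (Fin (2 + 1))) (param p y : S2) =
        2 * ‖y‖ ^ 2 * (‖y‖ ^ 2 + 4)⁻¹ := by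
      rw [innerSL_apply_apply, hvw, inner_neg_left, hvx]
      field_simp
      ring
    rw [h1, stereoToFun_apply, h2]
    change U' (_ • P _) = _
    rw [hx]
    simp only [map_add, map_smul, hPv, Submodule.coe_smul, smul_zero, add_zero, smul_smul]
    congr 1
    field_simp
  have := (extChartAt (𝓡 2) (-p)).left_inv hmem
  rw [hT] at this
  exact this.symm
/-- The change of coordinates from the chart at `p` to the chart at `-p`, defined away from the
origin. Its value at the origin is meaningless. -/
def transition (p : S2) (y : Plane) : Plane :=
  (exists_param_eq_param_neg p).choose ((‖y‖ ^ 2)⁻¹ • y)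

theorem param_eq_param_neg (p : S2) {y : Plane} (hy : y ≠ 0) :
    param p y = param (-p) (transition p y) :=
  (exists_param_eq_param_neg p).choose_spec y hy

theorem contDiffOn_transition (p : S2) : ContDiffOn ℝ ∞ (transition p) {0}ᶜ := by
  refine (exists_param_eq_param_neg p).choose.contDiff.comp_contDiffOn ?_
  have h : ContDiffOn ℝ ∞ (fun y : Plane => ‖y‖ ^ 2) {0}ᶜ := (contDiff_norm_sq ℝ).contDiffOn
  refine ContDiffOn.smul (h.inv fun x hx => ?_) contDiffOn_id
  have : x ≠ 0 := hx
  positivity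

theorem transition_smul (p : S2) (r : ℝ) (y : Plane) :
    transition p (r • y) = r⁻¹ • transition p y := by
  unfold transition
  rw [← map_smul, norm_smul, smul_smul, smul_smul]
  congr 2
  rw [mul_pow, Real.norm_eq_abs, sq_abs]
  by_cases hr : r = 0
  · simp [hr]
  · field_simp

/-- The Jacobian matrix `∂ᵢ Tᵃ` of the change of coordinates `T = transition p`. -/
def transJac (p : S2) (y : Plane) : Matrix (Fin 2) (Fin 2) ℝ :=
  Matrix.of fun a i => pd i (fun z => transition p z a) y

theorem differentiableAt_transition (p : S2) {y : Plane} (hy : y ≠ 0) :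
    DifferentiableAt ℝ (transition p) y :=
  ((contDiffOn_transition p).contDiffAt (isOpen_compl_singleton.mem_nhds hy)).differentiableAt
    (by simp)

theorem plane_eq_sum (u : Plane) : u = ∑ a, u a • e a := by
  ext i
  fin_cases i <;> simp [e, Fin.sum_univ_two]

theorem fderiv_transition_e (p : S2) {y : Plane} (hy : y ≠ 0) (i : Fin 2) :
    fderiv ℝ (transition p) y (e i) = ∑ a, transJac p y a i • e a := by
  rw [plane_eq_sum (fderiv ℝ (transition p) y (e i))]
  refine Finset.sum_congr rfl fun a _ => ?_
  congr 1
  have h := ((EuclideanSpace.proj (𝕜 := ℝ) a : Plane →L[ℝ] ℝ).hasFDerivAt.comp y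
    (differentiableAt_transition p hy).hasFDerivAt).fderiv
  change _ = fderiv ℝ ((EuclideanSpace.proj (𝕜 := ℝ) a : Plane →L[ℝ] ℝ) ∘ transition p) y (e i)
  rw [h]
  rfl

/-- The Jacobian of a map homogeneous of degree `-1` is homogeneous of degree `-2`. -/
theorem transJac_smul (p : S2) {r : ℝ} (hr : r ≠ 0) (y : Plane) :
    transJac p (r • y) = (r ^ 2)⁻¹ • transJac p y := by
  ext a i
  have h : fderiv ℝ (fun z => transition p (r • z) a) y = _ :=
    fderiv_comp_smul (f := fun z => transition p z a) (x := y) r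
  have h2 : (fun z => transition p (r • z) a) = fun z => r⁻¹ • transition p z a := by
    ext z
    rw [transition_smul]
    rfl
  rw [h2] at h
  have h3 : fderiv ℝ (fun z => r⁻¹ • transition p z a) y =
      r⁻¹ • fderiv ℝ (fun z => transition p z a) y :=
    congrFun (fderiv_const_smul_field (𝕜 := ℝ) (f := fun z => transition p z a) r⁻¹) y
  have h4 := congrArg (fun L : Plane →L[ℝ] ℝ => r⁻¹ * L (e i)) (h3.symm.trans h)
  simp only [smul_apply, smul_eq_mul, inv_mul_cancel_left₀ hr] at h4
  simp only [transJac, Matrix.of_apply, pd, Matrix.smul_apply, smul_eq_mul]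
  rw [← h4]
  field_simp

/-! ### Metrics and one-forms in opposite charts -/

/-- Chain rule for a factorization `f = f₁ ∘ T` near `y`. Both sides are regarded as endomorphisms
of the plane, since `f y` and `f₁ (T y)` are equal only propositionally. -/
theorem mfderiv_eq_comp_of_eventuallyEq {f f₁ : Plane → S2} {T : Plane → Plane} {y : Plane}
    (h : f =ᶠ[nhds y] f₁ ∘ T) (hf : MDifferentiableAt 𝓘(ℝ, Plane) (𝓡 2) f₁ (T y))
    (hT : DifferentiableAt ℝ T y) :
    (mfderiv 𝓘(ℝ, Plane) (𝓡 2) f y : Plane →L[ℝ] Plane) =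
      (mfderiv 𝓘(ℝ, Plane) (𝓡 2) f₁ (T y) : Plane →L[ℝ] Plane).comp (fderiv ℝ T y) :=
  ((hf.hasMFDerivAt.comp y hT.hasFDerivAt.hasMFDerivAt).congr_of_eventuallyEq h).mfderiv

/-- The differential of `param p` as an endomorphism of the plane, using that every tangent space
of the sphere is, by definition, the plane. -/
def dparam (p : S2) (y : Plane) : Plane →L[ℝ] Plane :=
  mfderiv 𝓘(ℝ, Plane) (𝓡 2) (param p) y

/-- The inner product at `x` as a bilinear form on the plane. -/
def metricAt (g : SphereMetric) (x : S2) : Plane →L[ℝ] Plane →L[ℝ] ℝ := g.inner x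

/-- The value at `x` of a one-form on the sphere, as a linear form on the plane. -/
def formAt (w : (x : S2) → TangentSpace (𝓡 2) x →L[ℝ] ℝ) (x : S2) : Plane →L[ℝ] ℝ := w x

theorem formCoord_eq_formAt (w : (x : S2) → TangentSpace (𝓡 2) x →L[ℝ] ℝ) (p : S2) (j : Fin 2)
    (y : Plane) : formCoord w p j y = formAt w (param p y) (dparam p y (e j)) := rfl

theorem metricCoord_eq_metricAt (g : SphereMetric) (p : S2) (y : Plane) (i j : Fin 2) :
    metricCoord g p y i j = metricAt g (param p y) (dparam p y (e i)) (dparam p y (e j)) :=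
  rfl

theorem dparam_eq_comp (p : S2) {y : Plane} (hy : y ≠ 0) :
    dparam p y = (dparam (-p) (transition p y)).comp (fderiv ℝ (transition p) y) := by
  refine mfderiv_eq_comp_of_eventuallyEq ?_ ((contMDiff_param (-p)).mdifferentiableAt (by simp))
    (differentiableAt_transition p hy)
  filter_upwards [isOpen_compl_singleton.mem_nhds hy] with z hz
  exact param_eq_param_neg p hz

theorem dparam_e (p : S2) {y : Plane} (hy : y ≠ 0) (i : Fin 2) :
    dparam p y (e i) = ∑ a, transJac p y a i • dparam (-p) (transition p y) (e a) := by
  rw [dparam_eq_comp p hy, ContinuousLinearMap.comp_apply, fderiv_transition_e p hy, map_sum]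
  simp only [map_smul]

/-- Transformation law of a one-form under the change between opposite charts. -/
theorem formCoord_eq_sum (w : (x : S2) → TangentSpace (𝓡 2) x →L[ℝ] ℝ) (p : S2) {y : Plane}
    (hy : y ≠ 0) (i : Fin 2) :
    formCoord w p i y = ∑ a, transJac p y a i * formCoord w (-p) a (transition p y) := by
  simp only [formCoord_eq_formAt]
  rw [param_eq_param_neg p hy, dparam_e p hy, map_sum]
  simp only [map_smul, smul_eq_mul]

/-- Transformation law of a metric under the change between opposite charts. -/
theorem metricCoord_eq (g : SphereMetric) (p : S2) {y : Plane} (hy : y ≠ 0) :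
    metricCoord g p y =
      (transJac p y).transpose * metricCoord g (-p) (transition p y) * transJac p y := by
  ext i j
  simp only [Matrix.mul_apply, Matrix.transpose_apply, metricCoord_eq_metricAt]
  rw [param_eq_param_neg p hy, dparam_e p hy, dparam_e p hy]
  simp only [map_smul, smul_apply, smul_eq_mul, Fin.sum_univ_two, map_add, add_apply]
  ring

/-! ### Positivity of the metric components -/

theorem metricCoord_symm (g : SphereMetric) (p : S2) (y : Plane) (i j : Fin 2) :
    metricCoord g p y i j = metricCoord g p y j i := g.symm _ _ _

theorem metricCoord_quadratic_pos (g : SphereMetric) (p : S2) (y : Plane) {a b : ℝ}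
    (h : a ≠ 0 ∨ b ≠ 0) :
    0 < metricCoord g p y 0 0 * a ^ 2 + 2 * metricCoord g p y 0 1 * a * b +
      metricCoord g p y 1 1 * b ^ 2 := by
  let g' := metricAt g (param p y)
  let D : Plane →L[ℝ] Plane := dparam p y
  let u : Plane := a • e 0 + b • e 1
  have hu : u ≠ 0 := by
    intro hu
    have h0 := congrArg (fun v : Plane => v 0) hu
    have h1 := congrArg (fun v : Plane => v 1) hu
    simp [u, e] at h0 h1
    tauto
  have hDu : D u ≠ 0 := fun h0 => hu (injective_mfderiv_param p y (h0.trans (map_zero D).symm))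
  have hpos : 0 < g' (D u) (D u) := g.pos (param p y) _ hDu
  have hs : g' (D (e 1)) (D (e 0)) = g' (D (e 0)) (D (e 1)) := g.symm _ _ _
  have : g' (D u) (D u) = g' (D (e 0)) (D (e 0)) * a ^ 2 + 2 * g' (D (e 0)) (D (e 1)) * a * b +
      g' (D (e 1)) (D (e 1)) * b ^ 2 := by
    simp only [u, map_add, map_smul, add_apply, smul_apply, smul_eq_mul, hs]
    ring
  rw [this] at hpos
  exact hpos

/-- Symmetric positive definite `2 × 2` matrices, by Sylvester's criterion. -/
structure IsPosSymm (M : Matrix (Fin 2) (Fin 2) ℝ) : Prop where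
  symm : M 1 0 = M 0 1
  pos : 0 < M 0 0
  det_pos : 0 < M.det

theorem isPosSymm_metricCoord (g : SphereMetric) (p : S2) (y : Plane) :
    IsPosSymm (metricCoord g p y) := by
  have h0 : 0 < metricCoord g p y 0 0 := by
    simpa using metricCoord_quadratic_pos g p y (a := 1) (b := 0) (by simp)
  refine ⟨metricCoord_symm g p y 1 0, h0, ?_⟩
  -- the vector `G₀₀ ∂₁ - G₀₁ ∂₀` is orthogonal to `∂₀`, with square length `G₀₀ det G`
  have h1 := metricCoord_quadratic_pos g p y (a := -metricCoord g p y 0 1)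
    (b := metricCoord g p y 0 0) (Or.inr h0.ne')
  rw [Matrix.det_fin_two, metricCoord_symm g p y 1 0]
  refine pos_of_mul_pos_right (a := metricCoord g p y 0 0) ?_ h0.le
  linarith

theorem det_transJac_ne_zero (p : S2) {y : Plane} (hy : y ≠ 0) : (transJac p y).det ≠ 0 := by
  intro h
  obtain ⟨v, hv, hv0⟩ := Matrix.exists_mulVec_eq_zero_iff.2 h
  have h1 : dparam p y (∑ i, v i • e i) = 0 := by
    rw [map_sum]
    simp only [map_smul, dparam_e p hy]
    simp only [Fin.sum_univ_two]
    have h0 := congrFun hv0 0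
    have h1 := congrFun hv0 1
    simp only [Matrix.mulVec, dotProduct, Fin.sum_univ_two, Pi.zero_apply] at h0 h1
    match_scalars <;> linarith
  have h2 : ∑ i, v i • e i = 0 := injective_mfderiv_param p y (h1.trans (map_zero _).symm)
  refine hv (funext fun i => ?_)
  have h3 := congrArg (fun w : Plane => w i) h2
  fin_cases i <;> simpa [e, Fin.sum_univ_two] using h3

theorem IsPosSymm.conj {M J : Matrix (Fin 2) (Fin 2) ℝ} (h : IsPosSymm M) (hJ : J.det ≠ 0) :
    IsPosSymm (J.transpose * M * J) := by
  have hs := h.symm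
  have hp := h.pos
  have hd := h.det_pos
  refine ⟨?_, ?_, ?_⟩
  · simp only [Matrix.mul_apply, Fin.sum_univ_two, Matrix.transpose_apply]
    rw [hs]; ring
  · simp only [Matrix.mul_apply, Fin.sum_univ_two, Matrix.transpose_apply]
    rw [Matrix.det_fin_two] at hd hJ
    refine pos_of_mul_pos_right (a := M 0 0) ?_ hp.le
    rw [hs] at *
    by_cases hb : J 1 0 = 0
    · have ha : J 0 0 ≠ 0 := by rintro ha; simp [ha, hb] at hJ
      rw [hb]
      have := sq_nonneg (J 0 0 * M 0 0)
      have : 0 < (J 0 0 * M 0 0) ^ 2 := by positivity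
      linarith
    · have : 0 < (M 0 0 * M 1 1 - M 0 1 * M 0 1) * J 1 0 ^ 2 := by positivity
      nlinarith [sq_nonneg (J 0 0 * M 0 0 + J 1 0 * M 0 1)]
  · rw [Matrix.det_mul, Matrix.det_mul, Matrix.det_transpose]
    have : 0 < J.det ^ 2 * M.det := by positivity
    linarith

/-! ### Partial derivatives in the plane -/

theorem contDiff_pd {f : Plane → ℝ} (hf : ContDiff ℝ ∞ f) (i : Fin 2) : ContDiff ℝ ∞ (pd i f) :=
  (hf.fderiv_right (m := ∞) (by simp)).clm_apply contDiff_const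

theorem pd_comm {f : Plane → ℝ} (hf : ContDiff ℝ ∞ f) (i j : Fin 2) (y : Plane) :
    pd i (pd j f) y = pd j (pd i f) y := by
  have h : IsSymmSndFDerivAt ℝ f y := hf.contDiffAt.isSymmSndFDerivAt (by
    simp only [minSmoothness_of_isRCLikeNormedField]
    exact WithTop.coe_le_coe.2 (le_top : (2 : ℕ∞) ≤ ⊤))
  have hd : DifferentiableAt ℝ (fderiv ℝ f) y :=
    ((hf.fderiv_right (m := ∞) (by simp)).differentiable (by simp)) y
  have key : ∀ k l, pd k (pd l f) y = fderiv ℝ (fderiv ℝ f) y (e k) (e l) := by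
    intro k l
    have := (hd.hasFDerivAt.clm_apply (hasFDerivAt_const (e l) y)).fderiv
    change fderiv ℝ (fun y => fderiv ℝ f y (e l)) y (e k) = _
    rw [this]
    simp
  rw [key, key]
  exact h _ _

section PartialDerivatives
variable {f g : Plane → ℝ} {y : Plane}

theorem pd_add (i : Fin 2) (hf : DifferentiableAt ℝ f y) (hg : DifferentiableAt ℝ g y) :
    pd i (fun z => f z + g z) y = pd i f y + pd i g y := by
  simp only [pd]; rw [fderiv_fun_add hf hg]; rfl

theorem pd_sub (i : Fin 2) (hf : DifferentiableAt ℝ f y) (hg : DifferentiableAt ℝ g y) :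
    pd i (fun z => f z - g z) y = pd i f y - pd i g y := by
  simp only [pd]; rw [fderiv_fun_sub hf hg]; rfl

theorem pd_mul (i : Fin 2) (hf : DifferentiableAt ℝ f y) (hg : DifferentiableAt ℝ g y) :
    pd i (fun z => f z * g z) y = f y * pd i g y + pd i f y * g y := by
  simp only [pd]; rw [fderiv_fun_mul hf hg]; simp; ring

theorem pd_div (i : Fin 2) (hf : DifferentiableAt ℝ f y) (hg : DifferentiableAt ℝ g y)
    (h0 : g y ≠ 0) :
    pd i (fun z => f z / g z) y = (pd i f y * g y - f y * pd i g y) / g y ^ 2 := by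
  have hg' : HasFDerivAt (fun z => (g z)⁻¹) (-(g y ^ 2)⁻¹ • fderiv ℝ g y) y :=
    (hasDerivAt_inv h0).comp_hasFDerivAt y hg.hasFDerivAt
  have h := (hf.hasFDerivAt.mul hg').fderiv
  simp only [pd, div_eq_mul_inv]
  change fderiv ℝ (f * fun z => (g z)⁻¹) y (e i) = _
  rw [h]
  simp only [add_apply, smul_apply, smul_eq_mul]
  field_simp
  ring

theorem pd_sqrt (i : Fin 2) (hf : DifferentiableAt ℝ f y) (h0 : f y ≠ 0) :
    pd i (fun z => Real.sqrt (f z)) y = pd i f y / (2 * Real.sqrt (f y)) := by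
  simp only [pd]; rw [hf.hasFDerivAt.sqrt h0 |>.fderiv]; simp; ring

end PartialDerivatives

/-! ### The curvature of a metric on the plane -/

/-- A smooth Riemannian metric on the plane, given by its components. -/
structure IsSmoothMetric (G : Plane → Matrix (Fin 2) (Fin 2) ℝ) : Prop where
  contDiff : ∀ i j, ContDiff ℝ ∞ fun y => G y i j
  symm : ∀ y, G y 1 0 = G y 0 1
  pos : ∀ y, 0 < G y 0 0
  det_pos : ∀ y, 0 < (G y).det

/-- The one-form `θⱼ = (√det G / G₀₀) Γ¹₀ⱼ`. It is the connection form of the orthonormal frame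
obtained from the coordinate frame by the Gram-Schmidt process. -/
def connForm (G : Plane → Matrix (Fin 2) (Fin 2) ℝ) (j : Fin 2) (y : Plane) : ℝ :=
  Real.sqrt (G y).det / G y 0 0 * christoffel G 1 0 j y

/-- The density `∂₁ θ₀ - ∂₀ θ₁`. By Liouville's formula it is the Gauss curvature times the area
density, see `ricci_eq`. -/
def gaussDensity (G : Plane → Matrix (Fin 2) (Fin 2) ℝ) (y : Plane) : ℝ :=
  pd 1 (connForm G 0) y - pd 0 (connForm G 1) y

variable {G : Plane → Matrix (Fin 2) (Fin 2) ℝ}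

theorem inv_apply_fin_two (M : Matrix (Fin 2) (Fin 2) ℝ) :
    M⁻¹ 0 0 = M 1 1 / M.det ∧ M⁻¹ 0 1 = - M 0 1 / M.det ∧ M⁻¹ 1 0 = - M 1 0 / M.det ∧
      M⁻¹ 1 1 = M 0 0 / M.det := by
  rw [Matrix.inv_def, Matrix.adjugate_fin_two, Ring.inverse_eq_inv]
  simp [div_eq_inv_mul]

theorem IsSmoothMetric.contDiff_det (hG : IsSmoothMetric G) : ContDiff ℝ ∞ fun y => (G y).det := by
  simp only [Matrix.det_fin_two]
  exact ((hG.contDiff 0 0).mul (hG.contDiff 1 1)).sub ((hG.contDiff 0 1).mul (hG.contDiff 1 0))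

theorem IsSmoothMetric.contDiff_inv (hG : IsSmoothMetric G) (i j : Fin 2) :
    ContDiff ℝ ∞ fun y => (G y)⁻¹ i j := by
  have h := fun y => inv_apply_fin_two (G y)
  have hd := fun y => (hG.det_pos y).ne'
  fin_cases i <;> fin_cases j
  · exact (funext fun y => (h y).1) ▸ (hG.contDiff 1 1).div hG.contDiff_det hd
  · exact (funext fun y => (h y).2.1) ▸ (hG.contDiff 0 1).neg.div hG.contDiff_det hd
  · exact (funext fun y => (h y).2.2.1) ▸ (hG.contDiff 1 0).neg.div hG.contDiff_det hd
  · exact (funext fun y => (h y).2.2.2) ▸ (hG.contDiff 0 0).div hG.contDiff_det hd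

theorem IsSmoothMetric.contDiff_christoffel (hG : IsSmoothMetric G) (k i j : Fin 2) :
    ContDiff ℝ ∞ (christoffel G k i j) := by
  refine contDiff_const.mul (ContDiff.sum fun l _ => (hG.contDiff_inv k l).mul ?_)
  exact ((contDiff_pd (hG.contDiff _ _) _).add (contDiff_pd (hG.contDiff _ _) _)).sub
    (contDiff_pd (hG.contDiff _ _) _)

theorem IsSmoothMetric.contDiff_connForm (hG : IsSmoothMetric G) (j : Fin 2) :
    ContDiff ℝ ∞ (connForm G j) :=
  ((hG.contDiff_det.sqrt fun y => (hG.det_pos y).ne').div (hG.contDiff 0 0)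
    fun y => (hG.pos y).ne').mul (hG.contDiff_christoffel _ _ _)

theorem IsSmoothMetric.symm' (hG : IsSmoothMetric G) (i j : Fin 2) (y : Plane) :
    G y i j = G y j i := by
  fin_cases i <;> fin_cases j <;> first | rfl | exact hG.symm y | exact (hG.symm y).symm

theorem christoffel_symm (hG : IsSmoothMetric G) (k i j : Fin 2) (y : Plane) :
    christoffel G k i j y = christoffel G k j i y := by
  unfold christoffel
  congr 1
  refine Finset.sum_congr rfl fun l _ => ?_
  have : (fun z => G z i j) = fun z => G z j i := funext fun z => hG.symm' i j z
  rw [this]; ring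

/-- The Christoffel symbols are compatible with the metric. -/
theorem pd_metric (hG : IsSmoothMetric G) (a i j : Fin 2) (y : Plane) :
    pd a (fun z => G z i j) y =
      ∑ k, (G y i k * christoffel G k a j y + G y j k * christoffel G k a i y) := by
  have hl : ∀ i a j, ∑ k, G y i k * christoffel G k a j y = (1 / 2) *
      (pd a (fun z => G z j i) y + pd j (fun z => G z a i) y - pd i (fun z => G z a j) y) := by
    intro i a j
    have h1 : G y * (G y)⁻¹ = 1 := Matrix.mul_nonsing_inv _ (hG.det_pos y).ne'.isUnit
    have h2 : ∀ l, G y i 0 * (G y)⁻¹ 0 l + G y i 1 * (G y)⁻¹ 1 l = if i = l then 1 else 0 := by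
      intro l
      have := congrFun (congrFun h1 i) l
      rwa [Matrix.mul_apply, Fin.sum_univ_two, Matrix.one_apply] at this
    have h20 := h2 0
    have h21 := h2 1
    simp only [christoffel, Fin.sum_univ_two]
    rw [show ∀ x₁ x₂ y₁ y₂ a b c d : ℝ,
      x₁ * (1 / 2 * (a * y₁ + b * y₂)) + x₂ * (1 / 2 * (c * y₁ + d * y₂)) =
        1 / 2 * ((x₁ * a + x₂ * c) * y₁ + (x₁ * b + x₂ * d) * y₂) by intros; ring]
    rw [h20, h21]
    fin_cases i <;> simp
  have hs : ∀ i j, (fun z => G z i j) = fun z => G z j i :=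
    fun i j => funext fun z => hG.symm' i j z
  rw [Finset.sum_add_distrib, hl, hl, hs j i, hs a i, hs a j]
  ring

/-- In dimension two the Ricci tensor is the Gauss curvature times the metric, and the Gauss
curvature is given by Liouville's formula, i.e. it is exact as a density in each chart. -/
theorem ricci_eq (hG : IsSmoothMetric G) (y : Plane) :
    ∀ i j, ricci G i j y = gaussDensity G y / Real.sqrt (G y).det * G y i j := by
  have hdG : ∀ i j, DifferentiableAt ℝ (fun z => G z i j) y := fun i j =>
    ((hG.contDiff i j).differentiable (by simp)) y
  have hdc : ∀ k i j, DifferentiableAt ℝ (christoffel G k i j) y := fun k i j =>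
    ((hG.contDiff_christoffel k i j).differentiable (by simp)) y
  have hpd : ∀ a i j, pd a (fun z => G z i j) = fun y =>
      ∑ k, (G y i k * christoffel G k a j y + G y j k * christoffel G k a i y) :=
    fun a i j => funext (pd_metric hG a i j)
  have hcomm : ∀ i j, pd 0 (pd 1 (fun z => G z i j)) y = pd 1 (pd 0 (fun z => G z i j)) y :=
    fun i j => pd_comm (hG.contDiff i j) 0 1 y
  have hsecond : ∀ a b i j, pd a (pd b (fun z => G z i j)) y =
      ∑ k, ((G y i k * pd a (christoffel G k b j) y
        + pd a (fun z => G z i k) y * christoffel G k b j y)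
        + (G y j k * pd a (christoffel G k b i) y
          + pd a (fun z => G z j k) y * christoffel G k b i y)) := by
    intro a b i j
    rw [hpd b i j]
    simp only [Fin.sum_univ_two]
    rw [pd_add, pd_add, pd_mul, pd_mul, pd_add, pd_mul, pd_mul]
    all_goals first | exact hdG _ _ | exact hdc _ _ _ | (try fun_prop (disch := assumption))
  have hs10 : ∀ z, G z 1 0 = G z 0 1 := hG.symm
  have hc10 : ∀ k, christoffel G k 1 0 = christoffel G k 0 1 := fun k =>
    funext (christoffel_symm hG k 1 0)
  have e00 := hcomm 0 0
  have e01 := hcomm 0 1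
  have e11 := hcomm 1 1
  simp only [hsecond, Fin.sum_univ_two, pd_metric hG, hs10, hc10] at e00 e01 e11
  -- the curvature endomorphism `Rᵏⱼ₀₁`
  obtain ⟨M, hM⟩ : ∃ M : Fin 2 → Fin 2 → ℝ, ∀ k j, M k j =
      pd 0 (christoffel G k 1 j) y - pd 1 (christoffel G k 0 j) y +
        ∑ m, (christoffel G k 0 m y * christoffel G m 1 j y -
          christoffel G k 1 m y * christoffel G m 0 j y) := ⟨_, fun _ _ => rfl⟩
  have hM00 := hM 0 0
  have hM01 := hM 0 1
  have hM10 := hM 1 0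
  have hM11 := hM 1 1
  simp only [Fin.sum_univ_two, hc10] at hM00 hM01 hM10 hM11
  -- `G M` is antisymmetric because second derivatives of the metric commute
  have a00 : G y 0 0 * M 0 0 + G y 0 1 * M 1 0 = 0 := by
    rw [hM00, hM10]; linear_combination e00 / 2
  have a11 : G y 0 1 * M 0 1 + G y 1 1 * M 1 1 = 0 := by
    rw [hM01, hM11]; linear_combination e11 / 2
  have a01 : G y 0 0 * M 0 1 + G y 0 1 * M 1 1 + G y 0 1 * M 0 0 + G y 1 1 * M 1 0 = 0 := by
    rw [hM00, hM10, hM01, hM11]; linear_combination e01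
  -- the Ricci tensor is the trace of the curvature, which in dimension two has a single term
  have r00 : ricci G 0 0 y = - M 1 0 := by
    simp only [ricci, Fin.sum_univ_two, hc10, hM10]; ring
  have r01 : ricci G 0 1 y = M 0 0 := by
    simp only [ricci, Fin.sum_univ_two, hc10, hM00]; ring
  have r10 : ricci G 1 0 y = - M 1 1 := by
    simp only [ricci, Fin.sum_univ_two, hc10, hM11]; ring
  have r11 : ricci G 1 1 y = M 0 1 := by
    simp only [ricci, Fin.sum_univ_two, hc10, hM01]; ring
  have hE := hG.pos y
  have hd := hG.det_pos y
  have hdet : (G y).det = G y 0 0 * G y 1 1 - G y 0 1 * G y 0 1 := by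
    rw [Matrix.det_fin_two, hs10]
  have hs := Real.sqrt_pos.2 hd
  have hsq : Real.sqrt (G y).det ^ 2 = (G y).det := Real.sq_sqrt hd.le
  have hddet : DifferentiableAt ℝ (fun z => (G z).det) y :=
    (hG.contDiff_det.differentiable (by simp)) y
  -- `∂ log (√det / G₀₀)` in terms of Christoffel symbols, by metric compatibility
  have hw : ∀ a, pd a (fun z => Real.sqrt (G z).det / G z 0 0) y =
      Real.sqrt (G y).det / G y 0 0 * (christoffel G 1 a 1 y - christoffel G 0 a 0 y -
        2 * (G y 0 1 / G y 0 0) * christoffel G 1 a 0 y) := by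
    intro a
    rw [pd_div a (hddet.sqrt hd.ne') (hdG 0 0) hE.ne', pd_sqrt a hddet hd.ne']
    have h1 : pd a (fun z => (G z).det) y =
        (G y 0 0 * pd a (fun z => G z 1 1) y + pd a (fun z => G z 0 0) y * G y 1 1) -
        (G y 0 1 * pd a (fun z => G z 1 0) y + pd a (fun z => G z 0 1) y * G y 1 0) := by
      simp only [Matrix.det_fin_two]
      rw [pd_sub a ((hdG 0 0).fun_mul (hdG 1 1)) ((hdG 0 1).fun_mul (hdG 1 0)),
        pd_mul a (hdG _ _) (hdG _ _), pd_mul a (hdG _ _) (hdG _ _)]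
    rw [h1]
    simp only [pd_metric hG, Fin.sum_univ_two, hs10]
    field_simp
    rw [hsq, hdet]
    ring
  have hK : gaussDensity G y = - (Real.sqrt (G y).det / G y 0 0) * M 1 0 := by
    have hdw : DifferentiableAt ℝ (fun z => Real.sqrt (G z).det / G z 0 0) y :=
      ((hG.contDiff_det.sqrt fun z => (hG.det_pos z).ne').div (hG.contDiff 0 0)
        fun z => (hG.pos z).ne').differentiable (by simp) y
    unfold gaussDensity
    have hc : ∀ j, connForm G j =
        fun z => Real.sqrt (G z).det / G z 0 0 * christoffel G 1 0 j z := fun j => rfl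
    rw [hc, hc, pd_mul 1 hdw (hdc _ _ _), pd_mul 0 hdw (hdc _ _ _), hw, hw, hM10]
    simp only [hc10]
    ring
  have hk : gaussDensity G y / Real.sqrt (G y).det = - M 1 0 / G y 0 0 := by
    rw [hK]; field_simp
  have m00 : M 0 0 = - M 1 0 / G y 0 0 * G y 0 1 := by
    field_simp; linarith
  have m01 : M 0 1 = - M 1 0 / G y 0 0 * G y 1 1 := by
    have : G y 0 0 * (G y).det * M 0 1 = - M 1 0 * G y 1 1 * (G y).det := by
      rw [hdet]
      linear_combination G y 0 0 * G y 1 1 * a01 - G y 0 0 * G y 0 1 * a11 -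
        G y 0 1 * G y 1 1 * a00
    have h2 : G y 0 0 * M 0 1 = - M 1 0 * G y 1 1 :=
      mul_right_cancel₀ hd.ne' (by linarith)
    field_simp
    linarith
  have m11 : - M 1 1 = - M 1 0 / G y 0 0 * G y 0 1 := by
    have : G y 0 0 * (G y).det * M 1 1 = M 1 0 * G y 0 1 * (G y).det := by
      rw [hdet]
      linear_combination - G y 0 0 * G y 0 1 * a01 + G y 0 0 * G y 0 0 * a11 +
        G y 0 1 * G y 0 1 * a00
    have h2 : G y 0 0 * M 1 1 = M 1 0 * G y 0 1 :=
      mul_right_cancel₀ hd.ne' (by linarith)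
    field_simp
    linarith
  intro i j
  rw [hk]
  fin_cases i <;> fin_cases j
  · exact r00.trans (div_mul_cancel₀ _ hE.ne').symm
  · exact r01.trans m00
  · exact r10.trans (m11.trans (by simp [hs10]))
  · exact r11.trans m01

/-! ### Smooth families of metrics -/

section Param
variable {P : Type*} [NormedAddCommGroup P] [NormedSpace ℝ P] {S : Set P} {U : Set Plane}

/-- Partial derivatives in the plane of a smooth function of a parameter and a point of the plane
are jointly smooth, also at boundary points of the parameter set. -/
theorem contDiffOn_pd_param {f : P → Plane → ℝ} (hS : UniqueDiffOn ℝ S) (hU : IsOpen U)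
    (hf : ContDiffOn ℝ ∞ (fun z : P × Plane => f z.1 z.2) (S ×ˢ U)) (i : Fin 2) :
    ContDiffOn ℝ ∞ (fun z : P × Plane => pd i (f z.1) z.2) (S ×ˢ U) := by
  have hSU : UniqueDiffOn ℝ (S ×ˢ U) := hS.prod hU.uniqueDiffOn
  have h1 := (hf.fderivWithin hSU (m := ∞) (by simp)).clm_apply
    (contDiffOn_const (c := ((0 : P), e i)))
  refine h1.congr fun z hz => ?_
  have h2 := ((hf.differentiableOn (by simp)) z hz).hasFDerivWithinAt
  have h3 : HasFDerivWithinAt (fun y => (z.1, y)) (ContinuousLinearMap.inr ℝ P Plane) U z.2 :=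
    (hasFDerivAt_prodMk_right z.1 z.2).hasFDerivWithinAt
  have h4 : HasFDerivWithinAt (f z.1) _ U z.2 :=
    HasFDerivWithinAt.comp (x := z.2) (f := fun y => (z.1, y)) (t := S ×ˢ U) h2 h3
      fun y hy => ⟨hz.1, hy⟩
  have h5 := (h4.hasFDerivAt (hU.mem_nhds hz.2)).fderiv
  simp only [pd]
  rw [h5]
  simp

/-- A family of Riemannian metrics on the open set `U` of the plane, depending smoothly on a
parameter in `S`. -/
structure IsSmoothFamily (G : P → Plane → Matrix (Fin 2) (Fin 2) ℝ) (S : Set P) (U : Set Plane) :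
    Prop where
  contDiffOn : ∀ i j, ContDiffOn ℝ ∞ (fun z : P × Plane => G z.1 z.2 i j) (S ×ˢ U)
  isPosSymm : ∀ p ∈ S, ∀ y ∈ U, IsPosSymm (G p y)

variable {G : P → Plane → Matrix (Fin 2) (Fin 2) ℝ}

theorem IsSmoothFamily.contDiffOn_det (hG : IsSmoothFamily G S U) :
    ContDiffOn ℝ ∞ (fun z : P × Plane => (G z.1 z.2).det) (S ×ˢ U) := by
  simp only [Matrix.det_fin_two]
  exact ((hG.contDiffOn 0 0).mul (hG.contDiffOn 1 1)).sub
    ((hG.contDiffOn 0 1).mul (hG.contDiffOn 1 0))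

theorem IsSmoothFamily.contDiffOn_sqrt_det (hG : IsSmoothFamily G S U) :
    ContDiffOn ℝ ∞ (fun z : P × Plane => Real.sqrt (G z.1 z.2).det) (S ×ˢ U) :=
  hG.contDiffOn_det.sqrt fun z hz => (hG.isPosSymm z.1 hz.1 z.2 hz.2).det_pos.ne'

theorem IsSmoothFamily.contDiffOn_inv (hG : IsSmoothFamily G S U) (i j : Fin 2) :
    ContDiffOn ℝ ∞ (fun z : P × Plane => (G z.1 z.2)⁻¹ i j) (S ×ˢ U) := by
  have h := fun z : P × Plane => inv_apply_fin_two (G z.1 z.2)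
  have hd : ∀ z ∈ S ×ˢ U, (G z.1 z.2).det ≠ 0 :=
    fun z hz => (hG.isPosSymm z.1 hz.1 z.2 hz.2).det_pos.ne'
  fin_cases i <;> fin_cases j
  · exact (funext fun z => (h z).1) ▸ (hG.contDiffOn 1 1).div hG.contDiffOn_det hd
  · exact (funext fun z => (h z).2.1) ▸ (hG.contDiffOn 0 1).neg.div hG.contDiffOn_det hd
  · exact (funext fun z => (h z).2.2.1) ▸ (hG.contDiffOn 1 0).neg.div hG.contDiffOn_det hd
  · exact (funext fun z => (h z).2.2.2) ▸ (hG.contDiffOn 0 0).div hG.contDiffOn_det hd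

theorem IsSmoothFamily.contDiffOn_christoffel (hG : IsSmoothFamily G S U) (hS : UniqueDiffOn ℝ S)
    (hU : IsOpen U) (k i j : Fin 2) :
    ContDiffOn ℝ ∞ (fun z : P × Plane => christoffel (G z.1) k i j z.2) (S ×ˢ U) := by
  have hp : ∀ a i j, ContDiffOn ℝ ∞ (fun z : P × Plane => pd a (fun y => G z.1 y i j) z.2)
      (S ×ˢ U) := fun a i j =>
    contDiffOn_pd_param (f := fun p y => G p y i j) hS hU (hG.contDiffOn i j) a
  refine contDiffOn_const.mul (ContDiffOn.sum fun l _ => (hG.contDiffOn_inv k l).mul ?_)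
  exact ((hp _ _ _).add (hp _ _ _)).sub (hp _ _ _)

theorem IsSmoothFamily.contDiffOn_connForm (hG : IsSmoothFamily G S U) (hS : UniqueDiffOn ℝ S)
    (hU : IsOpen U) (j : Fin 2) :
    ContDiffOn ℝ ∞ (fun z : P × Plane => connForm (G z.1) j z.2) (S ×ˢ U) :=
  (hG.contDiffOn_sqrt_det.div (hG.contDiffOn 0 0)
    fun z hz => (hG.isPosSymm z.1 hz.1 z.2 hz.2).pos.ne').mul
      (hG.contDiffOn_christoffel hS hU _ _ _)

end Param

/-! ### Rescaling at infinity -/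

/-- The connection form is unchanged when the metric is multiplied by a constant, and it is
pulled back under dilations. -/
theorem connForm_smul {G H : Plane → Matrix (Fin 2) (Fin 2) ℝ} {c R : ℝ} (hc : 0 < c) (hR : R ≠ 0)
    {y : Plane} (h : ∀ᶠ z in nhds y, G (R • z) = c • H z) (j : Fin 2) :
    R * connForm G j (R • y) = connForm H j y := by
  have hy := h.self_of_nhds
  have hpd : ∀ i a b, pd i (fun z => G z a b) (R • y) = R⁻¹ * c * pd i (fun z => H z a b) y := by
    intro i a b
    have h1 : fderiv ℝ (fun z => G (R • z) a b) y = _ :=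
      fderiv_comp_smul (f := fun z => G z a b) (x := y) R
    have h2 : (fun z => G (R • z) a b) =ᶠ[nhds y] fun z => c • H z a b := by
      filter_upwards [h] with z hz
      rw [hz]; rfl
    have h3 : fderiv ℝ (fun z => c • H z a b) y = c • fderiv ℝ (fun z => H z a b) y :=
      congrFun (fderiv_const_smul_field (𝕜 := ℝ) (f := fun z => H z a b) c) y
    rw [h2.fderiv_eq, h3] at h1
    have h4 := congrArg (fun L : Plane →L[ℝ] ℝ => R⁻¹ * L (e i)) h1
    simp only [smul_apply, smul_eq_mul, inv_mul_cancel_left₀ hR] at h4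
    simp only [pd]
    rw [← h4]
    ring
  have hdet : (c • H y).det = c ^ 2 * (H y).det := by rw [Matrix.det_smul]; simp
  have hinv : ∀ a b, (c • H y)⁻¹ a b = c⁻¹ * (H y)⁻¹ a b := by
    intro a b
    have h := inv_apply_fin_two (c • H y)
    have h' := inv_apply_fin_two (H y)
    have hx : ∀ x d : ℝ, c * x / (c ^ 2 * d) = c⁻¹ * (x / d) := fun x d => by field_simp
    simp only [hdet, Matrix.smul_apply, smul_eq_mul, ← mul_neg, hx] at h
    fin_cases a <;> fin_cases b
    · exact h.1.trans (congrArg (c⁻¹ * ·) h'.1.symm)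
    · exact h.2.1.trans (congrArg (c⁻¹ * ·) h'.2.1.symm)
    · exact h.2.2.1.trans (congrArg (c⁻¹ * ·) h'.2.2.1.symm)
    · exact h.2.2.2.trans (congrArg (c⁻¹ * ·) h'.2.2.2.symm)
  simp only [connForm, christoffel, hpd, hy, hinv, hdet, Fin.sum_univ_two, Matrix.smul_apply,
    smul_eq_mul]
  rw [Real.sqrt_mul (sq_nonneg c), Real.sqrt_sq hc.le]
  by_cases hE : H y 0 0 = 0
  · simp [hE]
  field_simp

/-- The metric with components `G` in the chart at `-p`, seen in the chart at `p` at scale `s⁻¹`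
and normalized (see `metricCoord_smul`). At `s = 0` it is the pullback under `transition p` of the
constant metric `G 0`. -/
def blowup (p : S2) (G : Plane → Matrix (Fin 2) (Fin 2) ℝ) (s : ℝ) (y : Plane) :
    Matrix (Fin 2) (Fin 2) ℝ :=
  (transJac p y).transpose * G (s • transition p y) * transJac p y

theorem metricCoord_smul (g : SphereMetric) (p : S2) {R : ℝ} (hR : R ≠ 0) {y : Plane} (hy : y ≠ 0) :
    metricCoord g p (R • y) = (R ^ 4)⁻¹ • blowup p (metricCoord g (-p)) R⁻¹ y := by
  rw [metricCoord_eq g p (smul_ne_zero hR hy), transJac_smul p hR, transition_smul, blowup,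
    Matrix.transpose_smul, Matrix.smul_mul, Matrix.smul_mul, Matrix.mul_smul, smul_smul]
  congr 1
  field_simp

/-- A one-form on the sphere, seen in the chart at `p` at scale `R`, tends to zero as `R → ∞`:
the right-hand side has the factor `R⁻¹`. -/
theorem formCoord_smul (w : (x : S2) → TangentSpace (𝓡 2) x →L[ℝ] ℝ) (p : S2) {R : ℝ} (hR : R ≠ 0)
    {y : Plane} (hy : y ≠ 0) (j : Fin 2) :
    R * formCoord w p j (R • y) =
      R⁻¹ * ∑ a, transJac p y a j * formCoord w (-p) a (R⁻¹ • transition p y) := by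
  rw [formCoord_eq_sum w p (smul_ne_zero hR hy), transJac_smul p hR, transition_smul,
    Finset.mul_sum, Finset.mul_sum]
  refine Finset.sum_congr rfl fun a _ => ?_
  rw [Matrix.smul_apply, smul_eq_mul]
  field_simp

theorem contDiffOn_transJac (p : S2) (a i : Fin 2) :
    ContDiffOn ℝ ∞ (fun y => transJac p y a i) {0}ᶜ := by
  have h : ContDiffOn ℝ ∞ (fun y => transition p y a) {0}ᶜ :=
    (EuclideanSpace.proj (𝕜 := ℝ) a : Plane →L[ℝ] ℝ).contDiff.comp_contDiffOn
      (contDiffOn_transition p)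
  exact (h.fderiv_of_isOpen isOpen_compl_singleton (m := ∞) (by simp)).clm_apply contDiffOn_const

/-- Functions in the chart at `-p` composed with the rescaled transition map are smooth in time,
the point and the scale `s`, including at `s = 0`. -/
theorem contDiffOn_comp_smul_transition (p : S2) {I : Set ℝ} {f : ℝ → Plane → ℝ}
    (hf : ContDiffOn ℝ ∞ (fun z : ℝ × Plane => f z.1 z.2) (I ×ˢ Set.univ)) :
    ContDiffOn ℝ ∞ (fun z : (ℝ × ℝ) × Plane => f z.1.2 (z.1.1 • transition p z.2))
      ((Set.univ ×ˢ I) ×ˢ {0}ᶜ) := by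
  have hT : ContDiffOn ℝ ∞ (fun z : (ℝ × ℝ) × Plane => transition p z.2)
      ((Set.univ ×ˢ I) ×ˢ {0}ᶜ) :=
    (contDiffOn_transition p).comp contDiff_snd.contDiffOn fun z hz => hz.2
  have hmap : ContDiffOn ℝ ∞ (fun z : (ℝ × ℝ) × Plane => (z.1.2, z.1.1 • transition p z.2))
      ((Set.univ ×ˢ I) ×ˢ {0}ᶜ) :=
    (contDiff_snd.comp contDiff_fst).contDiffOn.prodMk
      ((contDiff_fst.comp contDiff_fst).contDiffOn.smul hT)
  exact hf.comp hmap fun z hz => ⟨hz.1.2, trivial⟩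

theorem isSmoothFamily_blowup (p : S2) {I : Set ℝ} {G : ℝ → Plane → Matrix (Fin 2) (Fin 2) ℝ}
    (hG : IsSmoothFamily G I Set.univ) :
    IsSmoothFamily (fun q : ℝ × ℝ => blowup p (G q.2) q.1) (Set.univ ×ˢ I) {0}ᶜ where
  contDiffOn i j := by
    have hJ : ∀ a i, ContDiffOn ℝ ∞ (fun z : (ℝ × ℝ) × Plane => transJac p z.2 a i)
        ((Set.univ ×ˢ I) ×ˢ {0}ᶜ) := fun a i =>
      (contDiffOn_transJac p a i).comp contDiff_snd.contDiffOn fun z hz => hz.2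
    have hG' := fun a b => contDiffOn_comp_smul_transition p (f := fun t y => G t y a b)
      (hG.contDiffOn a b)
    simp only [blowup, Matrix.mul_apply, Matrix.transpose_apply]
    exact ContDiffOn.sum fun b _ => (ContDiffOn.sum fun a _ => (hJ a i).mul (hG' a b)).mul (hJ b j)
  isPosSymm q hq y hy :=
    (hG.isPosSymm q.2 hq.2 _ trivial).conj (det_transJac_ne_zero p hy)

/-! ### Stokes' theorem with a cutoff -/

theorem integral_mul_pd {χ f : Plane → ℝ} (hχ : ContDiff ℝ ∞ χ) (hc : HasCompactSupport χ)
    (hf : ContDiff ℝ ∞ f) (i : Fin 2) : ∫ y, χ y * pd i f y = - ∫ y, pd i χ y * f y := by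
  have hpχ : HasCompactSupport (pd i χ) := hc.fderiv_apply (𝕜 := ℝ) (e i)
  refine integral_mul_fderiv_eq_neg_fderiv_mul_of_integrable (v := e i) ?_ ?_ ?_ ?_ ?_
  · exact ((contDiff_pd hχ i).continuous.mul hf.continuous).integrable_of_hasCompactSupport
      hpχ.mul_right
  · exact (hχ.continuous.mul (contDiff_pd hf i).continuous).integrable_of_hasCompactSupport
      hc.mul_right
  · exact (hχ.continuous.mul hf.continuous).integrable_of_hasCompactSupport hc.mul_right
  · exact fun x _ => (hχ.differentiable (by simp)) x
  · exact fun x _ => (hf.differentiable (by simp)) x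

/-- The integral of `dχ ∧ η`, which for a cutoff function `χ` replaces the circulation of `η` along
a large circle. -/
def boundaryTerm (χ : Plane → ℝ) (η : Fin 2 → Plane → ℝ) : ℝ :=
  ∫ z, (pd 0 χ z * η 1 z - pd 1 χ z * η 0 z)

/-- Stokes' theorem with a cutoff function at scale `R`; the boundary term is rescaled to unit
size. -/
theorem integral_cutoff_mul_curl {χ : Plane → ℝ} (hχ : ContDiff ℝ ∞ χ) (hc : HasCompactSupport χ)
    {θ η : Fin 2 → Plane → ℝ} (hθ : ∀ j, ContDiff ℝ ∞ (θ j)) {R : ℝ} (hR : 0 < R)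
    (h0 : ∀ j, pd j χ 0 = 0)
    (hη : ∀ j z, z ≠ 0 → R * θ j (R • z) = η j z) :
    ∫ y, χ (R⁻¹ • y) * (pd 1 (θ 0) y - pd 0 (θ 1) y) = boundaryTerm χ η := by
  have hχR : ContDiff ℝ ∞ fun y : Plane => χ (R⁻¹ • y) := hχ.comp (contDiff_const_smul R⁻¹)
  have hcR : HasCompactSupport fun y : Plane => χ (R⁻¹ • y) :=
    hc.comp_homeomorph (Homeomorph.smulOfNeZero R⁻¹ (inv_ne_zero hR.ne'))
  have hpd : ∀ i y, pd i (fun y : Plane => χ (R⁻¹ • y)) y = R⁻¹ * pd i χ (R⁻¹ • y) := fun i y =>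
    congrArg (fun L : Plane →L[ℝ] ℝ => L (e i)) (fderiv_comp_smul (f := χ) (x := y) R⁻¹)
  have hint : ∀ i j, Integrable fun y => χ (R⁻¹ • y) * pd i (θ j) y := fun i j =>
    (hχR.continuous.mul (contDiff_pd (hθ j) i).continuous).integrable_of_hasCompactSupport
      hcR.mul_right
  have hint' : ∀ i j, Integrable fun y => pd i (fun y : Plane => χ (R⁻¹ • y)) y * θ j y :=
    fun i j => ((contDiff_pd hχR i).continuous.mul
      (hθ j).continuous).integrable_of_hasCompactSupport
        (HasCompactSupport.mul_right (hcR.fderiv_apply (𝕜 := ℝ) (e i)))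
  simp only [mul_sub]
  rw [integral_sub (hint 1 0) (hint 0 1), integral_mul_pd hχR hcR (hθ 0),
    integral_mul_pd hχR hcR (hθ 1), neg_sub_neg, ← integral_sub (hint' 0 1) (hint' 1 0)]
  have hF : ∀ y, pd 0 (fun y : Plane => χ (R⁻¹ • y)) y * θ 1 y -
      pd 1 (fun y : Plane => χ (R⁻¹ • y)) y * θ 0 y = (R⁻¹) ^ 2 *
        (fun z => pd 0 χ z * η 1 z - pd 1 χ z * η 0 z) (R⁻¹ • y) := by
    intro y
    rw [hpd, hpd]
    dsimp only
    by_cases hy : y = 0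
    · simp [hy, h0]
    · have hz : R⁻¹ • y ≠ 0 := smul_ne_zero (inv_ne_zero hR.ne') hy
      rw [← hη 0 _ hz, ← hη 1 _ hz, smul_inv_smul₀ hR.ne']
      field_simp
  rw [integral_congr_ae (Filter.Eventually.of_forall hF), integral_const_mul,
    Measure.integral_comp_smul volume (fun z => pd 0 χ z * η 1 z - pd 1 χ z * η 0 z) R⁻¹]
  simp only [finrank_euclideanSpace, Fintype.card_fin, smul_eq_mul, boundaryTerm]
  rw [abs_of_pos (by positivity), mul_inv_cancel_left₀ (by positivity)]

theorem continuousOn_boundaryTerm {P : Type*} [TopologicalSpace P]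
    [FirstCountableTopology P] {S : Set P} {χ : Plane → ℝ}
    (hχ : ContDiff ℝ ∞ χ) (hc : HasCompactSupport χ) (h0 : ∀ᶠ z in nhds 0, ∀ j, pd j χ z = 0)
    {η : P → Fin 2 → Plane → ℝ}
    (hη : ∀ j, ContinuousOn (fun z : P × Plane => η z.1 j z.2) (S ×ˢ {0}ᶜ)) :
    ContinuousOn (fun p => boundaryTerm χ (η p)) S := by
  refine continuousOn_integral_of_compact_support (k := tsupport χ) hc ?_ ?_
  · rintro ⟨p, z⟩ ⟨hp, -⟩
    by_cases hz : z = 0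
    · subst hz
      have h1 : ∀ᶠ q in nhdsWithin ((p, 0) : P × Plane) (S ×ˢ Set.univ), ∀ j, pd j χ q.2 = 0 :=
        nhdsWithin_le_nhds ((continuous_snd.tendsto ((p, 0) : P × Plane)).eventually h0)
      have h2 : (fun _ : P × Plane => (0 : ℝ)) =ᶠ[nhdsWithin (p, 0) (S ×ˢ Set.univ)]
          (fun p z => pd 0 χ z * η p 1 z - pd 1 χ z * η p 0 z).uncurry := by
        filter_upwards [h1] with q hq
        simp [Function.uncurry, hq]
      refine ContinuousWithinAt.congr_of_eventuallyEq continuousWithinAt_const h2.symm ?_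
      have := h0.self_of_nhds
      simp [Function.uncurry, this]
    · have hη' : ∀ j, ContinuousWithinAt (fun z : P × Plane => η z.1 j z.2)
          (S ×ˢ Set.univ) (p, z) := fun j => by
        refine (hη j (p, z) ⟨hp, hz⟩).mono_of_mem_nhdsWithin ?_
        have h1 : (Set.univ ×ˢ {0}ᶜ : Set (P × Plane)) ∈ nhds (p, z) :=
          (isOpen_univ.prod isOpen_compl_singleton).mem_nhds ⟨trivial, hz⟩
        filter_upwards [nhdsWithin_le_nhds h1, self_mem_nhdsWithin] with q hq hq'
        exact ⟨hq'.1, hq.2⟩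
      have hχ' : ∀ j, ContinuousWithinAt (fun z : P × Plane => pd j χ z.2)
          (S ×ˢ Set.univ) (p, z) := fun j =>
        ((contDiff_pd hχ j).continuous.comp continuous_snd).continuousWithinAt
      exact ((hχ' 0).mul (hη' 1)).sub ((hχ' 1).mul (hη' 0))
  · intro p z _ hz
    have h : ∀ j, pd j χ z = 0 := fun j => by
      have : z ∉ Function.support (fderiv ℝ χ) := fun h => hz (support_fderiv_subset ℝ h)
      rw [Function.notMem_support] at this
      simp [pd, this]
    simp [h]

/-- Tube lemma: a continuous function of `(s, t)` that equals `c` on `{0} × K`, with `K` compact,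
is uniformly close to `c` for small `s`. -/
theorem eventually_abs_sub_lt {f : ℝ × ℝ → ℝ} {I K : Set ℝ} (hf : ContinuousOn f (Set.univ ×ˢ I))
    (hK : IsCompact K) (hKI : K ⊆ I) {c : ℝ} (h0 : ∀ t ∈ K, f (0, t) = c) {ε : ℝ} (hε : 0 < ε) :
    ∀ᶠ s in nhds (0 : ℝ), ∀ t ∈ K, |f (s, t) - c| < ε := by
  have := hK.eventually_forall_of_forall_eventually (x₀ := (0 : ℝ))
    (P := fun s t => t ∈ K → |f (s, t) - c| < ε) fun t ht => ?_
  · filter_upwards [this] with s hs t ht using hs t ht ht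
  · have h1 : ContinuousWithinAt (fun z => |f z - c|) (Set.univ ×ˢ I) (0, t) :=
      ((hf (0, t) ⟨trivial, hKI ht⟩).sub continuousWithinAt_const).abs
    have h2 : ∀ᶠ z in nhdsWithin (0, t) (Set.univ ×ˢ I), |f z - c| < ε :=
      h1.eventually (gt_mem_nhds (by simpa [h0 t ht] using hε))
    filter_upwards [eventually_nhdsWithin_iff.1 h2] with z hz hzK using hz ⟨trivial, hKI hzK⟩

/-! ### Differences of connections -/

theorem IsSmoothFamily.isSmoothMetric {P : Type*} [NormedAddCommGroup P] [NormedSpace ℝ P]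
    {S : Set P} {G : P → Plane → Matrix (Fin 2) (Fin 2) ℝ} (hG : IsSmoothFamily G S Set.univ)
    {p : P} (hp : p ∈ S) : IsSmoothMetric (G p) where
  contDiff i j := by
    have h := (hG.contDiffOn i j).comp (s := Set.univ) (f := fun y : Plane => (p, y))
      (contDiff_prodMk_right p).contDiffOn fun y _ => ⟨hp, trivial⟩
    exact contDiffOn_univ.1 h
  symm y := (hG.isPosSymm p hp y trivial).symm
  pos y := (hG.isPosSymm p hp y trivial).pos
  det_pos y := (hG.isPosSymm p hp y trivial).det_pos

section Connection
variable {ι : Type*} {L : U1Bundle ι}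

theorem curvCoord_self (A : U1Connection L) (p : S2) (y : Plane) (i : Fin 2) :
    curvCoord A p y i i = 0 := sub_self _

theorem curvCoord_one_zero (A : U1Connection L) (p : S2) (y : Plane) :
    curvCoord A p y 1 0 = - curvCoord A p y 0 1 := (neg_sub _ _).symm

/-- The difference of two connections on the same bundle. It is a global one-form, because the
gauge terms cancel (see `connDiff_eq`). -/
def connDiff (A B : U1Connection L) (x : S2) : TangentSpace (𝓡 2) x →L[ℝ] ℝ :=
  A.form (L.indexAt x) x - B.form (L.indexAt x) x

theorem connDiff_eq (A B : U1Connection L) {α : ι} {x : S2} (hx : x ∈ L.baseSet α) :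
    connDiff A B x = A.form α x - B.form α x := by
  refine ContinuousLinearMap.ext fun v => ?_
  have h1 := A.gauge α (L.indexAt x) x hx (L.mem_baseSet_at x) v
  have h2 := B.gauge α (L.indexAt x) x hx (L.mem_baseSet_at x) v
  have h3 := h1.symm.trans h2
  have hτ : (L.trans α (L.indexAt x) x : ℂ) ≠ 0 := Circle.coe_ne_zero _
  have h4 := mul_left_cancel₀ Complex.I_ne_zero (mul_right_cancel₀ hτ h3)
  have h5 := Complex.ofReal_injective h4
  change A.form (L.indexAt x) x v - B.form (L.indexAt x) x v = A.form α x v - B.form α x v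
  linarith

theorem formCoord_connDiff (A B : U1Connection L) (p : S2) (j : Fin 2) {α : ι} {y : Plane}
    (hy : param p y ∈ L.baseSet α) : formCoord (connDiff A B) p j y =
      formCoord (A.form α) p j y - formCoord (B.form α) p j y := by
  simp only [formCoord, connDiff_eq A B hy]
  rfl

theorem isOpen_preimage_param (L : U1Bundle ι) (p : S2) (α : ι) :
    IsOpen (param p ⁻¹' L.baseSet α) :=
  (L.isOpen_baseSet α).preimage (contMDiff_param p).continuous

/-- The curvatures of two connections on the same bundle differ by an exact two-form. -/
theorem curvCoord_sub (A B : U1Connection L) (p : S2) (y : Plane) :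
    curvCoord A p y 0 1 - curvCoord B p y 0 1 =
      pd 0 (formCoord (connDiff A B) p 1) y - pd 1 (formCoord (connDiff A B) p 0) y := by
  have hV := (isOpen_preimage_param L p (L.indexAt (param p y))).mem_nhds
    (L.mem_baseSet_at (param p y))
  have hd : ∀ (A : U1Connection L) j,
      DifferentiableAt ℝ (formCoord (A.form (L.indexAt (param p y))) p j) y := fun A j =>
    ((A.smooth_form _ p j).contDiffAt hV).differentiableAt (by simp)
  have h : ∀ i j, pd i (formCoord (connDiff A B) p j) y =
      pd i (formCoord (A.form (L.indexAt (param p y))) p j) y -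
        pd i (formCoord (B.form (L.indexAt (param p y))) p j) y := by
    intro i j
    rw [← pd_sub i (hd A j) (hd B j)]
    have : formCoord (connDiff A B) p j =ᶠ[nhds y] fun z =>
        formCoord (A.form (L.indexAt (param p y))) p j z -
          formCoord (B.form (L.indexAt (param p y))) p j z := by
      filter_upwards [hV] with z hz using formCoord_connDiff A B p j hz
    simp only [pd, this.fderiv_eq]
  rw [h, h]
  simp only [curvCoord, Matrix.of_apply]
  ring

end Connection

/-! ### The flow in coordinates -/

namespace IsRYMFlow
variable {ι : Type*} {L : U1Bundle ι} {I : Set ℝ} {g : ℝ → SphereMetric} {A : ℝ → U1Connection L}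

theorem zero_mem (h : IsRYMFlow L I g A) : (0 : ℝ) ∈ I := h.isLeast.1

theorem uniqueDiffOn (h : IsRYMFlow L I g A) : UniqueDiffOn ℝ I :=
  uniqueDiffOn_convex h.ordConnected.convex
    (h.ordConnected.convex.nontrivial_iff_nonempty_interior.1 h.nontrivial)

theorem Icc_subset (h : IsRYMFlow L I g A) {T : ℝ} (hT : T ∈ I) : Set.Icc 0 T ⊆ I :=
  h.ordConnected.out h.zero_mem hT

theorem isSmoothFamily (h : IsRYMFlow L I g A) (p : S2) :
    IsSmoothFamily (fun t => metricCoord (g t) p) I Set.univ :=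
  ⟨h.smooth_metric p, fun _ _ _ _ => isPosSymm_metricCoord _ _ _⟩

theorem isSmoothMetric (h : IsRYMFlow L I g A) (p : S2) {t : ℝ} (ht : t ∈ I) :
    IsSmoothMetric (metricCoord (g t) p) := (h.isSmoothFamily p).isSmoothMetric ht

theorem contDiffOn_connDiff (h : IsRYMFlow L I g A) (p : S2) (j : Fin 2) :
    ContDiffOn ℝ ∞ (fun z : ℝ × Plane => formCoord (connDiff (A z.1) (A 0)) p j z.2)
      (I ×ˢ Set.univ) := by
  rintro ⟨t, y⟩ ⟨ht, -⟩
  have hV := (isOpen_preimage_param L p (L.indexAt (param p y)))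
  have hyV : y ∈ param p ⁻¹' L.baseSet (L.indexAt (param p y)) := L.mem_baseSet_at (param p y)
  have h1 := h.smooth_connection (L.indexAt (param p y)) p j
  have h2 : ContDiffOn ℝ ∞
      (fun z : ℝ × Plane => formCoord ((A 0).form (L.indexAt (param p y))) p j z.2)
      (I ×ˢ (param p ⁻¹' L.baseSet (L.indexAt (param p y)))) :=
    ((A 0).smooth_form (L.indexAt (param p y)) p j).comp contDiff_snd.contDiffOn fun z hz => hz.2
  have h3 := (h1.sub h2) (t, y) ⟨ht, hyV⟩
  have hmem : I ×ˢ (param p ⁻¹' L.baseSet (L.indexAt (param p y))) ∈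
      nhdsWithin (t, y) (I ×ˢ Set.univ) := by
    have h4 : Set.univ ×ˢ (param p ⁻¹' L.baseSet (L.indexAt (param p y))) ∈ nhds (t, y) :=
      (isOpen_univ.prod hV).mem_nhds ⟨trivial, hyV⟩
    filter_upwards [nhdsWithin_le_nhds h4, self_mem_nhdsWithin] with q hq hq' using ⟨hq'.1, hq.2⟩
  refine (h3.mono_of_mem_nhdsWithin hmem).congr_of_eventuallyEq ?_ ?_
  · filter_upwards [hmem] with q hq using formCoord_connDiff _ _ p j hq.2
  · exact formCoord_connDiff _ _ p j hyV

theorem contDiff_connDiff (h : IsRYMFlow L I g A) (p : S2) (j : Fin 2) {t : ℝ} (ht : t ∈ I) :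
    ContDiff ℝ ∞ (formCoord (connDiff (A t) (A 0)) p j) := by
  have := (h.contDiffOn_connDiff p j).comp (s := Set.univ) (f := fun y : Plane => (t, y))
      (contDiff_prodMk_right t).contDiffOn fun y _ => ⟨ht, trivial⟩
  exact contDiffOn_univ.1 this

/-- The factor `-2 K + |F|²` by which the flow multiplies the metric, `F` being the value of the
curvature component `F₀₁`, so that `|F|² = F² / det G`. -/
def growthRate (G : Plane → Matrix (Fin 2) (Fin 2) ℝ) (F : ℝ) (y : Plane) : ℝ :=
  -2 * (gaussDensity G y / Real.sqrt (G y).det) + F ^ 2 / (G y).det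

/-- The flow of metrics is conformal: its velocity is a multiple of the metric. -/
theorem hasDerivWithinAt_metricCoord (h : IsRYMFlow L I g A) (p : S2) (y : Plane) {t : ℝ}
    (ht : t ∈ I) (i j : Fin 2) :
    HasDerivWithinAt (fun s => metricCoord (g s) p y i j)
      (growthRate (metricCoord (g t) p) (curvCoord (A t) p y 0 1) y * metricCoord (g t) p y i j)
      I t := by
  have hG := h.isSmoothMetric p ht
  refine (h.metric_eq t ht p y i j).congr_deriv ?_
  rw [ricci_eq hG y i j]
  obtain ⟨h00, h01, h10, h11⟩ := inv_apply_fin_two (metricCoord (g t) p y)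
  have hd := (hG.det_pos y).ne'
  have hs := hG.symm y
  simp only [Fin.sum_univ_two, h00, h01, h10, h11, growthRate]
  have c00 := curvCoord_self (A t) p y 0
  have c11 := curvCoord_self (A t) p y 1
  have c10 := curvCoord_one_zero (A t) p y
  have hs10 : metricCoord (g t) p y 1 0 = metricCoord (g t) p y 0 1 := hs
  fin_cases i <;> fin_cases j <;>
    simp only [Fin.zero_eta, Fin.mk_one, Fin.isValue, c00, c11, c10, hs10] <;>
    field_simp <;> ring

/-- Evolution of the area density: `∂ₜ dV = -2 K dV + F₀₁² / dV`. -/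
theorem hasDerivWithinAt_sqrt_det (h : IsRYMFlow L I g A) (p : S2) (y : Plane) {t : ℝ}
    (ht : t ∈ I) :
    HasDerivWithinAt (fun s => Real.sqrt (metricCoord (g s) p y).det)
      (-2 * gaussDensity (metricCoord (g t) p) y +
        curvCoord (A t) p y 0 1 ^ 2 / Real.sqrt (metricCoord (g t) p y).det) I t := by
  have hG := h.isSmoothMetric p ht
  have hd := hG.det_pos y
  have hs := Real.sqrt_pos.2 hd
  have hD := h.hasDerivWithinAt_metricCoord p y ht
  have h1 := (((hD 0 0).mul (hD 1 1)).sub ((hD 0 1).mul (hD 1 0))).sqrt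
    (by rw [Matrix.det_fin_two] at hd; exact hd.ne')
  simp only [Matrix.det_fin_two]
  refine h1.congr_deriv ?_
  change _ / (2 * Real.sqrt (metricCoord (g t) p y 0 0 * metricCoord (g t) p y 1 1 -
    metricCoord (g t) p y 0 1 * metricCoord (g t) p y 1 0)) = _
  rw [← Matrix.det_fin_two]
  have hsq : (metricCoord (g t) p y).det = Real.sqrt (metricCoord (g t) p y).det ^ 2 :=
    (Real.sq_sqrt hd.le).symm
  have h2 : ∀ μ : ℝ, (μ * metricCoord (g t) p y 0 0 * metricCoord (g t) p y 1 1 +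
      metricCoord (g t) p y 0 0 * (μ * metricCoord (g t) p y 1 1) -
      (μ * metricCoord (g t) p y 0 1 * metricCoord (g t) p y 1 0 +
      metricCoord (g t) p y 0 1 * (μ * metricCoord (g t) p y 1 0))) =
        2 * μ * (metricCoord (g t) p y).det := by
    intro μ; rw [Matrix.det_fin_two]; ring
  rw [h2, growthRate]
  generalize Real.sqrt (metricCoord (g t) p y).det = q at *
  rw [hsq]
  field_simp

/-- The metrics of a flow are pointwise multiples of the initial one, as all ratios of components
are constant in time. -/
theorem exists_metricCoord_eq_smul (h : IsRYMFlow L I g A) (p : S2) (y : Plane) {t : ℝ}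
    (ht : t ∈ I) :
    ∃ c : ℝ, 0 < c ∧ metricCoord (g t) p y = c • metricCoord (g 0) p y := by
  have hpos : ∀ s, 0 < metricCoord (g s) p y 0 0 := fun s => (isPosSymm_metricCoord (g s) p y).pos
  have hconst : ∀ i j, metricCoord (g t) p y i j / metricCoord (g t) p y 0 0 =
      metricCoord (g 0) p y i j / metricCoord (g 0) p y 0 0 := by
    intro i j
    have hD : ∀ s ∈ I, HasDerivWithinAt
        (fun s => metricCoord (g s) p y i j / metricCoord (g s) p y 0 0) 0 I s := by
      intro s hs
      refine ((h.hasDerivWithinAt_metricCoord p y hs i j).div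
        (h.hasDerivWithinAt_metricCoord p y hs 0 0) (hpos s).ne').congr_deriv ?_
      field_simp
      ring
    exact h.ordConnected.convex.is_const_of_fderivWithin_eq_zero (𝕜 := ℝ)
      (fun s hs => (hD s hs).differentiableWithinAt)
      (fun s hs => by
        rw [(hD s hs).hasFDerivWithinAt.fderivWithin (h.uniqueDiffOn s hs)]
        ext; simp) ht h.zero_mem
  refine ⟨metricCoord (g t) p y 0 0 / metricCoord (g 0) p y 0 0, div_pos (hpos t) (hpos 0), ?_⟩
  ext i j
  have := hconst i j
  rw [div_eq_iff (hpos t).ne'] at this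
  rw [this, Matrix.smul_apply, smul_eq_mul]
  ring

end IsRYMFlow

/-! ### A barrier argument -/

/-- A function that starts above a barrier `C` and has positive derivative whenever it is below `C`
never gets below `C`. -/
theorem le_of_deriv_pos_of_lt {v : ℝ → ℝ} {T C : ℝ} (hT : 0 ≤ T)
    (hv : ContinuousOn v (Set.Icc 0 T)) (h0 : C ≤ v 0)
    (h : ∀ t ∈ Set.Ioo 0 T, v t < C → ∃ v', HasDerivAt v v' t ∧ 0 < v') : C ≤ v T := by
  by_contra! hlt
  have hK : IsCompact (Set.Icc 0 T ∩ v ⁻¹' Set.Ici C) :=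
    isCompact_Icc.of_isClosed_subset (hv.preimage_isClosed_of_isClosed isClosed_Icc isClosed_Ici)
      Set.inter_subset_left
  -- the last time at which the function is not below the barrier
  obtain ⟨t₀, ⟨ht₀, hC⟩, hmax⟩ := hK.exists_isGreatest ⟨0, ⟨le_rfl, hT⟩, h0⟩
  have htT : t₀ < T := lt_of_le_of_ne ht₀.2 fun h => hlt.not_ge (h ▸ hC)
  have hmono : StrictMonoOn v (Set.Icc t₀ T) := by
    refine strictMonoOn_of_deriv_pos (convex_Icc _ _)
      (hv.mono (Set.Icc_subset_Icc_left ht₀.1)) fun t ht => ?_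
    rw [interior_Icc] at ht
    have hvt : v t < C := by
      by_contra! hge
      exact ht.1.not_ge (hmax ⟨⟨ht₀.1.trans ht.1.le, ht.2.le⟩, hge⟩)
    obtain ⟨v', hv', hpos⟩ := h t ⟨ht₀.1.trans_lt ht.1, ht.2⟩ hvt
    rwa [hv'.deriv]
  exact (hlt.trans_le hC).not_ge (hmono ⟨le_rfl, htT.le⟩ ⟨htT.le, le_rfl⟩ htT).le

/-! ### Differentiation under the integral -/

section TimeDerivative
variable {I : Set ℝ} {f f' : ℝ → Plane → ℝ}

/-- The time derivative of a smooth family of functions is jointly continuous. -/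
theorem continuousOn_timeDeriv (hI : UniqueDiffOn ℝ I)
    (hf : ContDiffOn ℝ ∞ (fun z : ℝ × Plane => f z.1 z.2) (I ×ˢ Set.univ))
    (hf' : ∀ t ∈ I, ∀ y, HasDerivWithinAt (fun s => f s y) (f' t y) I t) :
    ContinuousOn (fun z : ℝ × Plane => f' z.1 z.2) (I ×ˢ Set.univ) := by
  have hIU : UniqueDiffOn ℝ (I ×ˢ (Set.univ : Set Plane)) := hI.prod uniqueDiffOn_univ
  have h1 : ContinuousOn (fun z => fderivWithin ℝ (fun z : ℝ × Plane => f z.1 z.2)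
      (I ×ˢ Set.univ) z ((1 : ℝ), (0 : Plane))) (I ×ˢ Set.univ) :=
    ((hf.fderivWithin hIU (m := ∞) (by simp)).clm_apply contDiffOn_const).continuousOn
  refine h1.congr fun z hz => ?_
  have h2 := ((hf.differentiableOn (by simp)) z hz).hasFDerivWithinAt
  have h3 : HasFDerivWithinAt (fun t => (t, z.2)) (ContinuousLinearMap.inl ℝ ℝ Plane) I z.1 :=
    (hasFDerivAt_prodMk_left z.1 z.2).hasFDerivWithinAt
  have h4 : HasFDerivWithinAt (fun t => f t z.2) _ I z.1 :=
    HasFDerivWithinAt.comp (x := z.1) (f := fun t => (t, z.2)) (t := I ×ˢ Set.univ) h2 h3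
      fun t ht => ⟨ht, trivial⟩
  have h5 := (hI z.1 hz.1).eq_deriv _ (hf' z.1 hz.1 z.2) h4.hasDerivWithinAt
  rw [h5]
  simp

theorem continuousOn_integral_mul {ψ : Plane → ℝ} (hψ : Continuous ψ) (hc : HasCompactSupport ψ)
    (hf : ContinuousOn (fun z : ℝ × Plane => f z.1 z.2) (I ×ˢ Set.univ)) :
    ContinuousOn (fun t => ∫ y, ψ y * f t y) I := by
  refine continuousOn_integral_of_compact_support (k := tsupport ψ) hc ?_ ?_
  · exact (hψ.comp continuous_snd).continuousOn.mul hf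
  · intro t y _ hy
    rw [image_eq_zero_of_notMem_tsupport hy, zero_mul]

theorem hasDerivAt_integral_mul {ψ : Plane → ℝ} (hψ : Continuous ψ) (hc : HasCompactSupport ψ)
    (hf : ContinuousOn (fun z : ℝ × Plane => f z.1 z.2) (I ×ˢ Set.univ))
    (hf'c : ContinuousOn (fun z : ℝ × Plane => f' z.1 z.2) (I ×ˢ Set.univ))
    (hf' : ∀ t ∈ I, ∀ y, HasDerivWithinAt (fun s => f s y) (f' t y) I t) {t : ℝ} (ht : I ∈ nhds t) :
    HasDerivAt (fun t => ∫ y, ψ y * f t y) (∫ y, ψ y * f' t y) t := by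
  obtain ⟨ε, hε, hball⟩ := Metric.nhds_basis_closedBall.mem_iff.1 ht
  have hslice : ∀ {F : ℝ → Plane → ℝ},
      ContinuousOn (fun z : ℝ × Plane => F z.1 z.2) (I ×ˢ Set.univ) → ∀ s ∈ I, Continuous (F s) :=
    fun hF s hs => continuousOn_univ.1 (hF.comp (f := fun y : Plane => (s, y)) (s := Set.univ)
      (by fun_prop) fun y _ => ⟨hs, trivial⟩)
  have hK : IsCompact (Metric.closedBall t ε ×ˢ tsupport ψ) := (isCompact_closedBall t ε).prod hc
  obtain ⟨B, hB⟩ := hK.exists_bound_of_continuousOn (f := fun z : ℝ × Plane => f' z.1 z.2)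
    (hf'c.mono (Set.prod_mono hball (Set.subset_univ _)))
  have hint : ∀ {F : Plane → ℝ}, Continuous F → Integrable fun y => ψ y * F y := fun hF =>
    (hψ.mul hF).integrable_of_hasCompactSupport hc.mul_right
  refine (hasDerivAt_integral_of_dominated_loc_of_deriv_le (s := Metric.ball t ε)
    (F' := fun s y => ψ y * f' s y) (bound := fun y => |ψ y| * B) (Metric.ball_mem_nhds t hε)
    ?_ ?_ ?_ ?_ ?_ ?_).2
  · filter_upwards [ht] with s hs
    exact (hint (hslice hf s hs)).aestronglyMeasurable
  · exact hint (hslice hf t (mem_of_mem_nhds ht))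
  · exact (hint (hslice hf'c t (mem_of_mem_nhds ht))).aestronglyMeasurable
  · refine Filter.Eventually.of_forall fun y s hs => ?_
    rw [norm_mul, Real.norm_eq_abs]
    by_cases hy : y ∈ tsupport ψ
    · exact mul_le_mul_of_nonneg_left (hB (s, y) ⟨Metric.ball_subset_closedBall hs, hy⟩)
        (abs_nonneg _)
    · simp [image_eq_zero_of_notMem_tsupport hy]
  · exact ((hψ.abs.mul continuous_const).integrable_of_hasCompactSupport hc.abs.mul_right)
  · refine Filter.Eventually.of_forall fun y s hs => ?_
    have hsI : I ∈ nhds s :=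
      Filter.mem_of_superset (Metric.isOpen_ball.mem_nhds hs)
        (Metric.ball_subset_closedBall.trans hball)
    exact ((hf' s (mem_of_mem_nhds hsI) y).hasDerivAt hsI).const_mul (ψ y)

end TimeDerivative

/-! ### The area density -/

theorem contMDiff_mfderiv_const {E E' H' M' : Type*} [NormedAddCommGroup E] [NormedSpace ℝ E]
    [NormedAddCommGroup E'] [NormedSpace ℝ E'] [TopologicalSpace H'] {J : ModelWithCorners ℝ E' H'}
    [TopologicalSpace M'] [ChartedSpace H' M'] [IsManifold J ∞ M'] {f : E → M'}
    (hf : ContMDiff 𝓘(ℝ, E) J ∞ f) (v : E) :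
    ContMDiff 𝓘(ℝ, E) J.tangent ∞
      (fun y => (⟨f y, mfderiv 𝓘(ℝ, E) J f y v⟩ : TangentBundle J M')) := by
  have h1 : ContMDiff 𝓘(ℝ, E).tangent J.tangent ∞ (tangentMap 𝓘(ℝ, E) J f) :=
    hf.contMDiff_tangentMap (by simp)
  have h2 := (contMDiff_vectorSpace_iff_contDiff (𝕜 := ℝ) (E := E) (n := ∞)
    (V := fun y => v)).2 contDiff_const
  exact h1.comp h2

theorem contMDiff_coordVec (p : S2) (i : Fin 2) :
    ContMDiff 𝓘(ℝ, Plane) (𝓡 2).tangent ∞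
      (fun y => (⟨param p y, coordVec p y i⟩ : TangentBundle (𝓡 2) S2)) :=
  contMDiff_mfderiv_const (contMDiff_param p) (e i)

theorem continuous_metricCoord (g : SphereMetric) (p : S2) (i j : Fin 2) :
    Continuous fun y => metricCoord g p y i j := by
  have h1 := g.contMDiff.comp (contMDiff_param p)
  have h2 := ContMDiff.clm_bundle_apply₂ (F₃ := ℝ) (E₃ := fun _ : S2 => ℝ)
    (ψ := fun y => g.inner (param p y)) (b := param p) h1
    (contMDiff_coordVec p i) (contMDiff_coordVec p j)
  rw [continuous_iff_continuousAt]
  intro y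
  exact ((Bundle.contMDiffAt_totalSpace).1 (h2 y)).2.continuousAt

theorem continuous_sqrt_det (g : SphereMetric) (p : S2) :
    Continuous fun y => Real.sqrt (metricCoord g p y).det := by
  have := continuous_metricCoord g p
  simp only [Matrix.det_fin_two]
  fun_prop

/-- The area density is integrable over the plane. By compactness of the unit circle and of the
range `[0, 1]` of the inverse scale it decays like `‖y‖⁻⁴`. -/
theorem integrable_sqrt_det (g : SphereMetric) (p : S2) :
    Integrable fun y => Real.sqrt (metricCoord g p y).det := by
  have hJ := fun a i => (contDiffOn_transJac p a i).continuousOn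
  have hcont : ContinuousOn
      (fun z : ℝ × Plane => Real.sqrt (blowup p (metricCoord g (-p)) z.1 z.2).det)
      (Set.univ ×ˢ {0}ᶜ) := by
    have hT : ContinuousOn (fun z : ℝ × Plane => z.1 • transition p z.2) (Set.univ ×ˢ {0}ᶜ) :=
      continuousOn_fst.smul
        ((contDiffOn_transition p).continuousOn.comp continuousOn_snd fun z hz => hz.2)
    have hG : ∀ a b, ContinuousOn
        (fun z : ℝ × Plane => metricCoord g (-p) (z.1 • transition p z.2) a b)
        (Set.univ ×ˢ {0}ᶜ) := fun a b => (continuous_metricCoord g (-p) a b).comp_continuousOn hT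
    have hJ' : ∀ a i, ContinuousOn (fun z : ℝ × Plane => transJac p z.2 a i) (Set.univ ×ˢ {0}ᶜ) :=
      fun a i => (hJ a i).comp continuousOn_snd fun z hz => hz.2
    simp only [blowup, Matrix.det_mul, Matrix.det_transpose, Matrix.det_fin_two]
    fun_prop
  have hK : IsCompact (Set.Icc (0 : ℝ) 1 ×ˢ Metric.sphere (0 : Plane) 1) :=
    isCompact_Icc.prod (isCompact_sphere 0 1)
  obtain ⟨B, hB⟩ := hK.exists_bound_of_continuousOn (hcont.mono fun z hz =>
    ⟨trivial, fun h0 : z.2 = 0 => by simpa [h0] using hz.2⟩)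
  obtain ⟨B', hB'⟩ := (isCompact_closedBall (0 : Plane) 1).exists_bound_of_continuousOn
    (continuous_sqrt_det g p).continuousOn
  have hB0 : 0 ≤ B' := (norm_nonneg _).trans (hB' 0 (by simp))
  refine Integrable.mono' (g := fun y => 16 * max B B' * (1 + ‖y‖) ^ (-(4 : ℝ)))
    ((integrable_one_add_norm (by simp; norm_num)).const_mul _)
    (continuous_sqrt_det g p).aestronglyMeasurable (Filter.Eventually.of_forall fun y => ?_)
  have hpos : 0 < 1 + ‖y‖ := by positivity
  rw [Real.rpow_neg hpos.le, ← div_eq_mul_inv, le_div_iff₀ (by positivity)]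
  norm_cast
  rcases le_total ‖y‖ 1 with hy | hy
  · have h1 := hB' y (by simpa using hy)
    have h2 : (1 + ‖y‖) ^ 4 ≤ 16 := by
      calc (1 + ‖y‖) ^ 4 ≤ (1 + 1) ^ 4 := by gcongr
        _ = 16 := by norm_num
    calc _ ≤ max B B' * 16 := mul_le_mul (h1.trans (le_max_right _ _)) h2 (by positivity)
          (hB0.trans (le_max_right _ _))
      _ = _ := by ring
  · have hy0 : ‖y‖ ≠ 0 := by linarith
    have hz0 : ‖y‖⁻¹ • y ≠ 0 := smul_ne_zero (inv_ne_zero hy0) (norm_ne_zero_iff.1 hy0)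
    have h1 := hB (‖y‖⁻¹, ‖y‖⁻¹ • y) ⟨⟨by positivity, inv_le_one_of_one_le₀ hy⟩, by
      simp [norm_smul, inv_mul_cancel₀ hy0]⟩
    have h3 := metricCoord_smul g p hy0 hz0
    rw [smul_inv_smul₀ hy0] at h3
    have h4 : Real.sqrt (metricCoord g p y).det = (‖y‖ ^ 4)⁻¹ *
        Real.sqrt (blowup p (metricCoord g (-p)) ‖y‖⁻¹ (‖y‖⁻¹ • y)).det := by
      rw [h3, Matrix.det_smul, Fintype.card_fin, Real.sqrt_mul (by positivity),
        Real.sqrt_sq (by positivity)]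
    rw [Real.norm_eq_abs, abs_of_nonneg (Real.sqrt_nonneg _)] at h1 ⊢
    rw [h4]
    dsimp only at h1
    have h2 : (1 + ‖y‖) ^ 4 ≤ 16 * ‖y‖ ^ 4 := by
      calc (1 + ‖y‖) ^ 4 ≤ (2 * ‖y‖) ^ 4 := by gcongr; linarith
        _ = 16 * ‖y‖ ^ 4 := by ring
    calc _ ≤ ((‖y‖ ^ 4)⁻¹ * max B B') * (16 * ‖y‖ ^ 4) := by
          gcongr
          exact h1.trans (le_max_left _ _)
      _ = _ := by field_simp

/-! ### Cut-off volumes and fluxes -/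

/-- A smooth cutoff function on the plane, equal to `1` on the unit disc and supported in the disc
of radius `2`. -/
def cutoff : ContDiffBump (0 : Plane) := ⟨1, 2, one_pos, one_lt_two⟩

theorem contDiff_cutoff : ContDiff ℝ ∞ cutoff := cutoff.contDiff

theorem eventually_pd_cutoff_eq_zero : ∀ᶠ z in nhds (0 : Plane), ∀ j, pd j cutoff z = 0 := by
  have h := (cutoff.eventuallyEq_one).eventuallyEq_nhds
  filter_upwards [h] with z hz j
  simp only [pd, hz.fderiv_eq]
  simp

theorem contDiff_cutoff_smul (s : ℝ) : ContDiff ℝ ∞ fun y : Plane => cutoff (s • y) :=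
  contDiff_cutoff.comp (contDiff_const_smul s)

theorem hasCompactSupport_cutoff_smul {s : ℝ} (hs : s ≠ 0) :
    HasCompactSupport fun y : Plane => cutoff (s • y) :=
  cutoff.hasCompactSupport.comp_homeomorph (Homeomorph.smulOfNeZero s hs)

theorem integrable_cutoff_mul {s : ℝ} (hs : s ≠ 0) {f : Plane → ℝ} (hf : Continuous f) :
    Integrable fun y => cutoff (s • y) * f y :=
  ((contDiff_cutoff_smul s).continuous.mul hf).integrable_of_hasCompactSupport
    (hasCompactSupport_cutoff_smul hs).mul_right

theorem integrable_cutoff_mul' (s : ℝ) {f : Plane → ℝ} (hf : Integrable f) :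
    Integrable fun y => cutoff (s • y) * f y :=
  hf.bdd_mul (c := 1) (contDiff_cutoff_smul s).continuous.aestronglyMeasurable
    (Filter.Eventually.of_forall fun y => by
      rw [Real.norm_eq_abs, abs_of_nonneg cutoff.nonneg]; exact cutoff.le_one)

theorem tendsto_integral_cutoff_mul {f : Plane → ℝ} (hf : Integrable f) :
    Filter.Tendsto (fun s : ℝ => ∫ y, cutoff (s • y) * f y) (nhds 0) (nhds (∫ y, f y)) := by
  refine tendsto_integral_filter_of_dominated_convergence (fun y => |f y|) ?_ ?_ hf.abs ?_
  · exact Filter.Eventually.of_forall fun s => (integrable_cutoff_mul' s hf).aestronglyMeasurable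
  · refine Filter.Eventually.of_forall fun s => Filter.Eventually.of_forall fun y => ?_
    rw [norm_mul, Real.norm_eq_abs, Real.norm_eq_abs, abs_of_nonneg cutoff.nonneg]
    exact mul_le_of_le_one_left (abs_nonneg _) cutoff.le_one
  · refine Filter.Eventually.of_forall fun y => ?_
    have h1 : Continuous fun s : ℝ => cutoff (s • y) * f y :=
      (contDiff_cutoff.continuous.comp (continuous_id.smul continuous_const)).mul continuous_const
    have h2 := h1.tendsto 0
    have h3 : cutoff (0 : Plane) = 1 := cutoff.one_of_mem_closedBall (by simp [cutoff])
    simpa [h3] using h2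

/-- The volume cut off at scale `s⁻¹` in the chart at `pole`. -/
def cutoffVol (g : SphereMetric) (s : ℝ) : ℝ :=
  ∫ y, cutoff (s • y) * Real.sqrt (metricCoord g pole y).det

theorem cutoffVol_pos (g : SphereMetric) {s : ℝ} (hs : s ≠ 0) : 0 < cutoffVol g s := by
  refine Continuous.integral_pos_of_hasCompactSupport_nonneg_nonzero (x := 0)
    ((contDiff_cutoff_smul s).continuous.mul (continuous_sqrt_det g pole))
    (hasCompactSupport_cutoff_smul hs).mul_right
    (fun y => mul_nonneg cutoff.nonneg (Real.sqrt_nonneg _)) ?_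
  have h3 : cutoff (0 : Plane) = 1 := cutoff.one_of_mem_closedBall (by simp [cutoff])
  rw [smul_zero, h3, one_mul]
  exact (Real.sqrt_pos.2 (isPosSymm_metricCoord g pole 0).det_pos).ne'

theorem cutoffVol_le_Vol (g : SphereMetric) (s : ℝ) : cutoffVol g s ≤ Vol g :=
  integral_mono (integrable_cutoff_mul' s (integrable_sqrt_det g pole)) (integrable_sqrt_det g pole)
    fun _ => mul_le_of_le_one_left (Real.sqrt_nonneg _) cutoff.le_one

theorem cutoffVol_one_le (g : SphereMetric) {s : ℝ} (hs : 0 ≤ s) (hs' : s ≤ 1 / 2) :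
    cutoffVol g 1 ≤ cutoffVol g s := by
  refine integral_mono (integrable_cutoff_mul' 1 (integrable_sqrt_det g pole))
    (integrable_cutoff_mul' s (integrable_sqrt_det g pole)) fun y => ?_
  refine mul_le_mul_of_nonneg_right ?_ (Real.sqrt_nonneg _)
  rw [one_smul]
  by_cases hy : ‖y‖ < 2
  · have : cutoff (s • y) = 1 := by
      refine cutoff.one_of_mem_closedBall ?_
      rw [mem_closedBall_zero_iff, norm_smul, Real.norm_eq_abs, abs_of_nonneg hs]
      change s * ‖y‖ ≤ 1
      nlinarith [norm_nonneg y]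
    rw [this]
    exact cutoff.le_one
  · have : cutoff y = 0 := cutoff.zero_of_le_dist (by
      rw [dist_zero_right]; exact not_lt.1 hy)
    rw [this]
    exact cutoff.nonneg

/-- The cut-off total curvature at scale `s⁻¹`, as a boundary term; `G'` are the components of the
metric in the chart at `-pole`. This expression makes sense at `s = 0` too, where it is the total
curvature of the sphere. -/
def curvatureFlux (G' : Plane → Matrix (Fin 2) (Fin 2) ℝ) (s : ℝ) : ℝ :=
  boundaryTerm cutoff (connForm (blowup pole G' s))

/-- The cut-off integral of `-dw` at scale `s⁻¹`, as a boundary term; it vanishes at `s = 0`. -/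
def formFlux (w : (x : S2) → TangentSpace (𝓡 2) x →L[ℝ] ℝ) (s : ℝ) : ℝ :=
  boundaryTerm cutoff fun j z =>
    s * ∑ a, transJac pole z a j * formCoord w (-pole) a (s • transition pole z)

theorem integral_cutoff_mul_gaussDensity (g : SphereMetric)
    (hg : IsSmoothMetric (metricCoord g pole)) {s : ℝ} (hs : 0 < s) :
    ∫ y, cutoff (s • y) * gaussDensity (metricCoord g pole) y =
      curvatureFlux (metricCoord g (-pole)) s := by
  have h := integral_cutoff_mul_curl contDiff_cutoff cutoff.hasCompactSupport
    (θ := connForm (metricCoord g pole))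
    (η := connForm (blowup pole (metricCoord g (-pole)) s)) hg.contDiff_connForm
    (inv_pos.2 hs) eventually_pd_cutoff_eq_zero.self_of_nhds fun j z hz => by
      refine connForm_smul (c := ((s⁻¹) ^ 4)⁻¹) (by positivity) (inv_ne_zero hs.ne') ?_ j
      filter_upwards [isOpen_compl_singleton.mem_nhds hz] with w hw
      rw [metricCoord_smul g pole (inv_ne_zero hs.ne') hw, inv_inv]
  rw [inv_inv] at h
  exact h

theorem integral_cutoff_mul_curl_formCoord (w : (x : S2) → TangentSpace (𝓡 2) x →L[ℝ] ℝ)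
    (hw : ∀ j, ContDiff ℝ ∞ (formCoord w pole j)) {s : ℝ} (hs : 0 < s) :
    ∫ y, cutoff (s • y) * (pd 1 (formCoord w pole 0) y - pd 0 (formCoord w pole 1) y) =
      formFlux w s := by
  have h := integral_cutoff_mul_curl contDiff_cutoff cutoff.hasCompactSupport
    (θ := formCoord w pole) (η := fun j z =>
      s * ∑ a, transJac pole z a j * formCoord w (-pole) a (s • transition pole z)) hw
    (inv_pos.2 hs) eventually_pd_cutoff_eq_zero.self_of_nhds fun j z hz => by
      rw [formCoord_smul w pole (inv_ne_zero hs.ne') hz, inv_inv]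
  rw [inv_inv] at h
  exact h

/-! ### Evolution of the cut-off volume -/

namespace IsRYMFlow
variable {ι : Type*} {L : U1Bundle ι} {I : Set ℝ} {g : ℝ → SphereMetric} {A : ℝ → U1Connection L}

theorem continuousOn_curvatureFlux (h : IsRYMFlow L I g A) :
    ContinuousOn (fun q : ℝ × ℝ => curvatureFlux (metricCoord (g q.2) (-pole)) q.1)
      (Set.univ ×ˢ I) := by
  refine continuousOn_boundaryTerm (η := fun q : ℝ × ℝ =>
    connForm (blowup pole (metricCoord (g q.2) (-pole)) q.1)) contDiff_cutoff
    cutoff.hasCompactSupport eventually_pd_cutoff_eq_zero fun j => ?_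
  exact ((isSmoothFamily_blowup pole (h.isSmoothFamily (-pole))).contDiffOn_connForm
    (uniqueDiffOn_univ.prod h.uniqueDiffOn) isOpen_compl_singleton j).continuousOn

/-- The total curvature is constant along the flow: at infinity in the chart at `pole` only the
metric at the point `-pole` is seen, and it changes by a constant factor. -/
theorem curvatureFlux_zero (h : IsRYMFlow L I g A) {t : ℝ} (ht : t ∈ I) :
    curvatureFlux (metricCoord (g t) (-pole)) 0 = curvatureFlux (metricCoord (g 0) (-pole)) 0 := by
  obtain ⟨c, hc, hct⟩ := h.exists_metricCoord_eq_smul (-pole) 0 ht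
  have hb : ∀ z, blowup pole (metricCoord (g t) (-pole)) 0 z =
      c • blowup pole (metricCoord (g 0) (-pole)) 0 z := by
    intro z
    simp only [blowup, zero_smul, hct, Matrix.mul_smul, Matrix.smul_mul]
  have hcf : connForm (blowup pole (metricCoord (g t) (-pole)) 0) =
      connForm (blowup pole (metricCoord (g 0) (-pole)) 0) := by
    ext j y
    have := connForm_smul (G := blowup pole (metricCoord (g t) (-pole)) 0)
      (H := blowup pole (metricCoord (g 0) (-pole)) 0) (y := y) hc one_ne_zero
      (Filter.Eventually.of_forall fun z => by rw [one_smul, hb]) j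
    simpa using this
  rw [curvatureFlux, hcf, curvatureFlux]

theorem continuousOn_formFlux (h : IsRYMFlow L I g A) :
    ContinuousOn (fun q : ℝ × ℝ => formFlux (connDiff (A q.2) (A 0)) q.1) (Set.univ ×ˢ I) := by
  refine continuousOn_boundaryTerm (η := fun (q : ℝ × ℝ) j z => q.1 *
    ∑ a, transJac pole z a j * formCoord (connDiff (A q.2) (A 0)) (-pole) a
      (q.1 • transition pole z)) contDiff_cutoff
    cutoff.hasCompactSupport eventually_pd_cutoff_eq_zero fun j => ?_
  have hJ : ∀ a, ContinuousOn (fun z : (ℝ × ℝ) × Plane => transJac pole z.2 a j)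
      ((Set.univ ×ˢ I) ×ˢ {0}ᶜ) := fun a =>
    (contDiffOn_transJac pole a j).continuousOn.comp continuousOn_snd fun z hz => hz.2
  have hw := fun a => (contDiffOn_comp_smul_transition pole (I := I)
    (f := fun t => formCoord (connDiff (A t) (A 0)) (-pole) a)
    (h.contDiffOn_connDiff (-pole) a)).continuousOn
  exact (continuous_fst.comp continuous_fst).continuousOn.mul
    (continuousOn_finsetSum _ fun a _ => (hJ a).mul (hw a))

/-- The cut-off integral of the curvature is constant in time up to a boundary term. -/
theorem integral_cutoff_mul_curvCoord (h : IsRYMFlow L I g A)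
    (hF : Integrable fun y => curvCoord (A 0) pole y 0 1) {t : ℝ} (ht : t ∈ I) {s : ℝ}
    (hs : 0 < s) :
    Integrable (fun y => cutoff (s • y) * curvCoord (A t) pole y 0 1) ∧
    ∫ y, cutoff (s • y) * curvCoord (A t) pole y 0 1 =
      (∫ y, cutoff (s • y) * curvCoord (A 0) pole y 0 1) - formFlux (connDiff (A t) (A 0)) s := by
  have hw := fun j => h.contDiff_connDiff pole j ht
  have hi1 : Integrable fun y => cutoff (s • y) *
      (pd 1 (formCoord (connDiff (A t) (A 0)) pole 0) y -
        pd 0 (formCoord (connDiff (A t) (A 0)) pole 1) y) :=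
    integrable_cutoff_mul hs.ne'
      ((contDiff_pd (hw 0) 1).continuous.sub (contDiff_pd (hw 1) 0).continuous)
  have hi0 := integrable_cutoff_mul' s hF
  have heq : (fun y => cutoff (s • y) * curvCoord (A t) pole y 0 1) = fun y =>
      cutoff (s • y) * curvCoord (A 0) pole y 0 1 - cutoff (s • y) *
      (pd 1 (formCoord (connDiff (A t) (A 0)) pole 0) y -
        pd 0 (formCoord (connDiff (A t) (A 0)) pole 1) y) := by
    ext y
    have := curvCoord_sub (A t) (A 0) pole y
    rw [show curvCoord (A t) pole y 0 1 = curvCoord (A 0) pole y 0 1 +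
      (curvCoord (A t) pole y 0 1 - curvCoord (A 0) pole y 0 1) by ring, this]
    ring
  rw [heq]
  refine ⟨hi0.sub hi1, ?_⟩
  rw [integral_sub hi0 hi1, integral_cutoff_mul_curl_formCoord _ hw hs]

theorem continuousOn_cutoffVol (h : IsRYMFlow L I g A) {s : ℝ} (hs : s ≠ 0) :
    ContinuousOn (fun t => cutoffVol (g t) s) I :=
  continuousOn_integral_mul (contDiff_cutoff_smul s).continuous (hasCompactSupport_cutoff_smul hs)
    (h.isSmoothFamily pole).contDiffOn_sqrt_det.continuousOn

/-- The differential inequality for the volume: `v' ≥ -2 ∫ K dV + (∫ F)² / v`, with cutoffs. -/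
theorem exists_hasDerivAt_cutoffVol (h : IsRYMFlow L I g A)
    (hF : Integrable fun y => curvCoord (A 0) pole y 0 1) {t : ℝ} (ht : I ∈ nhds t) {s : ℝ}
    (hs : 0 < s) :
    ∃ v', HasDerivAt (fun t => cutoffVol (g t) s) v' t ∧
      -2 * curvatureFlux (metricCoord (g t) (-pole)) s +
        (∫ y, cutoff (s • y) * curvCoord (A t) pole y 0 1) ^ 2 / cutoffVol (g t) s ≤ v' := by
  have htI := mem_of_mem_nhds ht
  have hG := h.isSmoothMetric pole htI
  have hsm := (h.isSmoothFamily pole).contDiffOn_sqrt_det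
  have hderiv := fun t (ht : t ∈ I) y => h.hasDerivWithinAt_sqrt_det pole y ht
  have hcont := continuousOn_timeDeriv (f := fun t y => Real.sqrt (metricCoord (g t) pole y).det)
    h.uniqueDiffOn hsm hderiv
  have hv' := hasDerivAt_integral_mul (contDiff_cutoff_smul s).continuous
    (hasCompactSupport_cutoff_smul hs.ne') hsm.continuousOn hcont hderiv ht
  refine ⟨_, hv', ?_⟩
  have hcont_t : Continuous fun y => -2 * gaussDensity (metricCoord (g t) pole) y +
      curvCoord (A t) pole y 0 1 ^ 2 / Real.sqrt (metricCoord (g t) pole y).det :=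
    continuousOn_univ.1 (hcont.comp (f := fun y : Plane => (t, y)) (s := Set.univ)
      (by fun_prop) fun y _ => ⟨htI, trivial⟩)
  obtain ⟨hFi, -⟩ := h.integral_cutoff_mul_curvCoord hF htI hs
  set N := ∫ y, cutoff (s • y) * curvCoord (A t) pole y 0 1 with hN
  have hv0 := cutoffVol_pos (g t) hs.ne'
  set a := N / cutoffVol (g t) s with ha
  have hK : Continuous (gaussDensity (metricCoord (g t) pole)) :=
    (contDiff_pd (hG.contDiff_connForm 0) 1).continuous.sub
      (contDiff_pd (hG.contDiff_connForm 1) 0).continuous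
  have hi1 := (integrable_cutoff_mul hs.ne' hK).const_mul (-2)
  have hi2 := hFi.const_mul (2 * a)
  have hi3 := (integrable_cutoff_mul hs.ne' (continuous_sqrt_det (g t) pole)).const_mul (a ^ 2)
  have hi12 : Integrable fun y =>
      -2 * (cutoff (s • y) * gaussDensity (metricCoord (g t) pole) y) +
        2 * a * (cutoff (s • y) * curvCoord (A t) pole y 0 1) := hi1.add hi2
  have hlow : ∫ y, (-2 * (cutoff (s • y) * gaussDensity (metricCoord (g t) pole) y) +
      2 * a * (cutoff (s • y) * curvCoord (A t) pole y 0 1) -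
      a ^ 2 * (cutoff (s • y) * Real.sqrt (metricCoord (g t) pole y).det)) =
      -2 * curvatureFlux (metricCoord (g t) (-pole)) s + N ^ 2 / cutoffVol (g t) s := by
    rw [integral_sub hi12 hi3, integral_add hi1 hi2, integral_const_mul,
      integral_const_mul, integral_const_mul, integral_cutoff_mul_gaussDensity (g t) hG hs, ← hN]
    change _ + _ - a ^ 2 * cutoffVol (g t) s = _
    rw [ha]
    field_simp
    ring
  rw [← hlow]
  refine integral_mono (hi12.sub hi3) (integrable_cutoff_mul hs.ne' hcont_t) fun y => ?_
  have hd := Real.sqrt_pos.2 (hG.det_pos y)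
  dsimp only
  set d := Real.sqrt (metricCoord (g t) pole y).det
  set F := curvCoord (A t) pole y 0 1
  -- the Cauchy-Schwarz inequality, in the form that is optimal for this value of `a`
  have hsq : 2 * a * F - a ^ 2 * d ≤ F ^ 2 / d := by
    rw [le_div_iff₀ hd]
    nlinarith [sq_nonneg (F - a * d)]
  have hχ : 0 ≤ cutoff (s • y) := cutoff.nonneg
  nlinarith [mul_le_mul_of_nonneg_left hsq hχ]

end IsRYMFlow

end RYM

end

open RYM in
theorem mainTheorem5 (g₀ : RYM.SphereMetric) (c : ℝ) (hc : 0 < c) :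
    ∃ C : ℝ, 0 < C ∧
      ∀ (ι : Type*) (L : RYM.U1Bundle ι) (I : Set ℝ) (g : ℝ → RYM.SphereMetric)
        (A : ℝ → RYM.U1Connection L),
        RYM.IsRYMFlow L I g A → g 0 = g₀ → |RYM.curvClass (A 0)| = c →
          ∀ t ∈ I, C ≤ RYM.Vol (g t) := by
  -- the total curvature of `g₀`; its sign is irrelevant here
  set κ := |curvatureFlux (metricCoord g₀ (-pole)) 0| with hκ
  have hκ0 : 0 ≤ κ := abs_nonneg _
  refine ⟨min (cutoffVol g₀ 1) (c ^ 2 / (8 * (κ + 1))),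
    lt_min (cutoffVol_pos g₀ one_ne_zero) (by positivity), ?_⟩
  intro ι L I g A h hg0 hA T hT
  -- otherwise the integral defining `curvClass` would have the junk value `0`
  have hF : Integrable fun y => curvCoord (A 0) pole y 0 1 := by
    by_contra hni
    have : curvClass (A 0) = 0 := integral_undef hni
    rw [this, abs_zero] at hA
    exact hc.ne hA
  have hI := h.Icc_subset hT
  -- a scale at which the boundary terms are close to their limits for all times up to `T`
  have e1 := eventually_abs_sub_lt h.continuousOn_curvatureFlux isCompact_Icc hI
    (fun t ht => h.curvatureFlux_zero (hI ht)) one_pos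
  have e2 := eventually_abs_sub_lt h.continuousOn_formFlux isCompact_Icc hI (c := 0)
    (fun t ht => by simp [formFlux, boundaryTerm]) (show 0 < c / 4 by positivity)
  have e3 := (Metric.tendsto_nhds.1 (tendsto_integral_cutoff_mul hF)) (c / 4) (by positivity)
  have e4 : ∀ᶠ s in nhds (0 : ℝ), s < 1 / 2 := gt_mem_nhds (by norm_num)
  obtain ⟨s, ⟨⟨⟨h1, h2⟩, h3⟩, h4⟩, hs : 0 < s⟩ :=
    ((((e1.and e2).and e3).and e4).filter_mono nhdsWithin_le_nhds).and
      (self_mem_nhdsWithin : Set.Ioi (0 : ℝ) ∈ nhdsWithin 0 (Set.Ioi 0)) |>.exists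
  refine le_trans ?_ (cutoffVol_le_Vol (g T) s)
  refine le_of_deriv_pos_of_lt (v := fun t => cutoffVol (g t) s) (h.isLeast.2 hT)
    ((h.continuousOn_cutoffVol hs.ne').mono hI) ?_ fun t ht hlt => ?_
  · rw [hg0]
    exact (min_le_left _ _).trans (cutoffVol_one_le g₀ hs.le h4.le)
  · have htI : t ∈ Set.Icc 0 T := ⟨ht.1.le, ht.2.le⟩
    have hnhds : I ∈ nhds t := Filter.mem_of_superset (Icc_mem_nhds ht.1 ht.2) hI
    obtain ⟨v', hv', hle⟩ := h.exists_hasDerivAt_cutoffVol hF hnhds hs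
    refine ⟨v', hv', lt_of_lt_of_le ?_ hle⟩
    obtain ⟨-, hN⟩ := h.integral_cutoff_mul_curvCoord hF (hI htI) hs
    have b1 := h1 t htI
    have b2 := h2 t htI
    rw [hg0] at b1
    rw [Real.dist_eq] at h3
    change |_ - curvClass (A 0)| < _ at h3
    rw [sub_zero] at b2
    set N := ∫ y, cutoff (s • y) * curvCoord (A t) pole y 0 1
    have hNc : c / 2 ≤ |N| := by
      have t1 : |curvClass (A 0)| - |N| ≤ |curvClass (A 0) - N| := abs_sub_abs_le_abs_sub _ _
      have t2 : |curvClass (A 0) - N| ≤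
          |(∫ y, cutoff (s • y) * curvCoord (A 0) pole y 0 1) - curvClass (A 0)| +
            |formFlux (connDiff (A t) (A 0)) s| := by
        rw [hN, ← abs_neg (_ - curvClass (A 0))]
        refine le_trans (le_of_eq (congrArg abs ?_)) (abs_add_le _ _)
        ring
      linarith
    have hvC : cutoffVol (g t) s < c ^ 2 / (8 * (κ + 1)) := hlt.trans_le (min_le_right _ _)
    have hv0 := cutoffVol_pos (g t) hs.ne'
    have hk : curvatureFlux (metricCoord (g t) (-pole)) s < κ + 1 := by
      have t1 := (abs_lt.1 b1).2
      have t2 := le_abs_self (curvatureFlux (metricCoord g₀ (-pole)) 0)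
      linarith
    have hN2 : c ^ 2 / 4 ≤ N ^ 2 := by
      rw [← sq_abs N]
      nlinarith
    have hq : 2 * (κ + 1) < N ^ 2 / cutoffVol (g t) s := by
      rw [lt_div_iff₀ hv0]
      rw [lt_div_iff₀ (by positivity)] at hvC
      linarith
    linarith
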